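/- Let $0<a<\infty$, put $p(t)=1-t^2/a^2$, and consider on $(-a,a)$ the differential expression $$(Lx)(t)=-\frac{d}{dt}\Big(p(t)\frac{dx(t)}{dt}\Big)+t^2x(t).$$ Let $\mathcal L_I$ be the operator in $L^2((-a,a))$ (complex-valued functions) given by $\mathcal L_Ix=Lx$ on the domain consisting of all $x\in L^2((-a,a))$ such that $x$ is differentiable at every point of $(-a,a)$, $x'$ is absolutely continuous on every compact subinterval of $(-a,a)$, $Lx\in L^2((-a,a))$, and $$\lim_{t\to-a+0}(t+a)\,x'(t)=0,\qquad \lim_{t\to a-0}(t-a)\,x'(t)=0 .$$ Then $\mathcal L_I$ is self-adjoint, and: 1. $\mathcal L_I$ has discrete spectrum: every point of its spectrum is an isolated point of the spectrum and an eigenvalue of finite multiplicity. 2. The spectrum of $\mathcal L_I$ is the set of members of a strictly increasing infinite sequence $\mu_0<\mu_1<\mu_2<\cdots$ of positive eigenvalues with $\mu_n\to+\infty$, each of multiplicity one. 3. A number $\lambda\in\mathbb C$ is an eigenvalue of $\mathcal L_I$ if and only if there is a twice differentiable function $e:(-a,a)\to\mathbb C$, not identically zero, such that $$-\frac{d}{dt}\Big(\Big(1-\frac{t^2}{a^2}\Big)\frac{de(t)}{dt}\Big)+t^2e(t)=\lambda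 e(t),\qquad -a<t<a,$$ and both limits $e(-a)=\lim_{t\to-a+0}e(t)$ and $e(a)=\lim_{t\to a-0}e(t)$ exist and are finite. Every such $e$ is an eigenvector of $\mathcal L_I$ corresponding to the eigenvalue $\lambda$. -/

import Mathlib

open Set Filter Topology MeasureTheory

noncomputable section

namespace Prolate

/-! ### Unbounded operators: resolvent set, spectrum, eigenspaces -/

section Abstract

variable {E : Type*} [NormedAddCommGroup E] [NormedSpace ℂ E]

/-- `z` is in the resolvent set of `A` if `A - z` maps the domain of `A` bijectively onto `E`
and the inverse is a bounded operator `R` on `E`. -/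
def resolventSet (A : E →ₗ.[ℂ] E) : Set ℂ :=
  {z | ∃ R : E →L[ℂ] E,
    (∀ f : E, ∃ h : R f ∈ A.domain, A ⟨R f, h⟩ - z • R f = f) ∧
    ∀ x : A.domain, R (A x - z • (x : E)) = x}

/-- The spectrum of an unbounded operator. -/
def spectrum (A : E →ₗ.[ℂ] E) : Set ℂ := (resolventSet A)ᶜ

/-- The eigenspace `{f ∈ dom A : A f = z f}`. -/
def eigenspace (A : E →ₗ.[ℂ] E) (z : ℂ) : Submodule ℂ E where
  carrier := {f | ∃ h : f ∈ A.domain, A ⟨f, h⟩ = z • f}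
  zero_mem' := ⟨A.domain.zero_mem, by
    rw [smul_zero]; exact A.map_zero⟩
  add_mem' := by
    rintro f g ⟨hf, hf'⟩ ⟨hg, hg'⟩
    refine ⟨A.domain.add_mem hf hg, ?_⟩
    have := A.map_add ⟨f, hf⟩ ⟨g, hg⟩
    rw [smul_add, ← hf', ← hg', ← this]
    rfl
  smul_mem' := by
    rintro c f ⟨hf, hf'⟩
    refine ⟨A.domain.smul_mem c hf, ?_⟩
    have := A.map_smul c ⟨f, hf⟩
    rw [smul_comm, ← hf', ← this]
    rfl

/-- `z` is an eigenvalue of `A`. -/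
def HasEigenvalue (A : E →ₗ.[ℂ] E) (z : ℂ) : Prop :=
  ∃ f ∈ eigenspace A z, f ≠ 0

/-- Discrete spectrum: every point of the spectrum is an isolated point of the spectrum and an
eigenvalue of finite multiplicity. -/
def HasDiscreteSpectrum (A : E →ₗ.[ℂ] E) : Prop :=
  ∀ z ∈ spectrum A,
    (∃ ε > 0, ∀ w ∈ spectrum A, dist w z < ε → w = z) ∧
    HasEigenvalue A z ∧ FiniteDimensional ℂ (eigenspace A z)

end Abstract

/-! ### The prolate spheroid differential expression and its maximal domain -/

/-- Lebesgue measure on the open interval `(-a, a)`. -/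
abbrev intervalMeasure (a : ℝ) : Measure ℝ := volume.restrict (Ioo (-a) a)

/-- The Hilbert space `L²((-a, a))` of complex-valued functions. -/
abbrev HilbertL2 (a : ℝ) : Type := Lp ℂ 2 (intervalMeasure a)

/-- `(p x')(t)`, where `p(t) = 1 - t² / a²`. -/
def flux (a : ℝ) (x : ℝ → ℂ) (t : ℝ) : ℂ := ((1 - t ^ 2 / a ^ 2 : ℝ) : ℂ) * deriv x t

/-- The formal differential operator `(L x)(t) = - (p x')'(t) + t² x(t)`. -/
def formalL (a : ℝ) (x : ℝ → ℂ) (t : ℝ) : ℂ :=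
  -deriv (flux a x) t + ((t ^ 2 : ℝ) : ℂ) * x t

/-- The functions that are differentiable at every point of `(-a, a)` and whose derivative is
absolutely continuous on every compact subinterval of `(-a, a)`. Functions are total, but only
their values on `(-a, a)` matter. -/
def classA (a : ℝ) : Set (ℝ → ℂ) :=
  {x | (∀ t ∈ Ioo (-a) a, DifferentiableAt ℝ x t) ∧
    ∀ α β : ℝ, -a < α → α ≤ β → β < a → AbsolutelyContinuousOnInterval (deriv x) α β}

/-- The domain of the maximal operator: `x ∈ L² ∩ A` with `L x ∈ L²`. -/
def domainMax (a : ℝ) : Set (ℝ → ℂ) :=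
  {x | x ∈ classA a ∧ MemLp x 2 (intervalMeasure a) ∧ MemLp (formalL a x) 2 (intervalMeasure a)}

/-- The domain of `L_I`: the functions `x` in the maximal domain whose generalized boundary values
`b_{-a}(x) = lim_{t → -a+0} (t + a) x'(t)` and `b_a(x) = lim_{t → a-0} (t - a) x'(t)` vanish. -/
def domainI (a : ℝ) : Set (ℝ → ℂ) :=
  {x | x ∈ domainMax a ∧
    Tendsto (fun t : ℝ => ((t + a : ℝ) : ℂ) * deriv x t) (𝓝[>] (-a)) (𝓝 0) ∧
    Tendsto (fun t : ℝ => ((t - a : ℝ) : ℂ) * deriv x t) (𝓝[<] a) (𝓝 0)}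

lemma ae_differentiableAt_deriv {a : ℝ} {x : ℝ → ℂ} (hx : x ∈ classA a) :
    ∀ᵐ t ∂(intervalMeasure a), DifferentiableAt ℝ (deriv x) t := by
  rw [ae_restrict_iff' measurableSet_Ioo]
  have key : ∀ n : ℕ, ∀ᵐ t : ℝ, t ∈ Ioo (-a + 1 / ((n : ℝ) + 1)) (a - 1 / ((n : ℝ) + 1)) →
      DifferentiableAt ℝ (deriv x) t := by
    intro n
    have hn : (0 : ℝ) < 1 / ((n : ℝ) + 1) := by positivity
    by_cases h : -a + 1 / ((n : ℝ) + 1) ≤ a - 1 / ((n : ℝ) + 1)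
    · have := (hx.2 _ _ (by linarith) h
        (by linarith)).boundedVariationOn.ae_differentiableAt_of_mem_uIcc
      filter_upwards [this] with t ht hmem
      exact ht (by rw [uIcc_of_le h]; exact Ioo_subset_Icc_self hmem)
    · exact ae_of_all _ fun t ht => absurd (ht.1.trans ht.2).le h
  rw [← ae_all_iff] at key
  filter_upwards [key] with t ht hmem
  obtain ⟨n, hn⟩ := exists_nat_one_div_lt
    (show (0 : ℝ) < min (t + a) (a - t) from lt_min (by linarith [hmem.1]) (by linarith [hmem.2]))
  have h1 := hn.trans_le (min_le_left _ _)
  have h2 := hn.trans_le (min_le_right _ _)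
  exact ht n ⟨by linarith, by linarith⟩

lemma differentiableAt_flux {a : ℝ} {x : ℝ → ℂ} {t : ℝ} (h : DifferentiableAt ℝ (deriv x) t) :
    DifferentiableAt ℝ (flux a x) t := by
  unfold flux
  refine DifferentiableAt.mul ?_ h
  have h1 : DifferentiableAt ℝ (fun s : ℝ => 1 - s ^ 2 / a ^ 2) t := by fun_prop
  exact Complex.ofRealCLM.differentiableAt.comp t h1

lemma formalL_add {a : ℝ} {x y : ℝ → ℂ} (hx : x ∈ classA a) (hy : y ∈ classA a) :
    formalL a (x + y) =ᵐ[intervalMeasure a] formalL a x + formalL a y := by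
  filter_upwards [ae_differentiableAt_deriv hx, ae_differentiableAt_deriv hy,
    ae_restrict_mem measurableSet_Ioo] with t h1 h2 ht
  have : flux a (x + y) =ᶠ[𝓝 t] flux a x + flux a y := by
    filter_upwards [isOpen_Ioo.mem_nhds ht] with s hs
    simp only [flux, Pi.add_apply, deriv_add (hx.1 s hs) (hy.1 s hs)]
    ring
  simp only [formalL, this.deriv_eq, Pi.add_apply,
    deriv_add (differentiableAt_flux (a := a) h1) (differentiableAt_flux (a := a) h2)]
  ring

lemma deriv_smul_fun (c : ℂ) (x : ℝ → ℂ) : deriv (c • x) = c • deriv x := by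
  ext t
  exact deriv_const_smul_field c x

lemma formalL_smul (a : ℝ) (c : ℂ) (x : ℝ → ℂ) : formalL a (c • x) = c • formalL a x := by
  have : flux a (c • x) = c • flux a x := by
    ext t
    simp only [flux, deriv_smul_fun, Pi.smul_apply, smul_eq_mul]
    ring
  ext t
  simp only [formalL, this, deriv_smul_fun, Pi.smul_apply, smul_eq_mul]
  ring

lemma zero_mem_domainI (a : ℝ) : (0 : ℝ → ℂ) ∈ domainI a := by
  have h0 : deriv (0 : ℝ → ℂ) = 0 := by ext t; exact deriv_const t 0
  have hL : formalL a 0 = 0 := by simpa using formalL_smul a 0 0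
  refine ⟨⟨⟨fun t _ => differentiableAt_const 0, fun α β _ _ _ => ?_⟩, MemLp.zero, ?_⟩, ?_, ?_⟩
  · rw [h0]
    exact (LipschitzWith.const (0 : ℂ)).lipschitzOnWith.absolutelyContinuousOnInterval
  · rw [hL]; exact MemLp.zero
  · simp [h0]
  · simp [h0]

lemma add_mem_domainI {a : ℝ} (ha : 0 < a) {x y : ℝ → ℂ} (hx : x ∈ domainI a)
    (hy : y ∈ domainI a) : x + y ∈ domainI a := by
  have hd : ∀ t ∈ Ioo (-a) a, deriv (x + y) t = deriv x t + deriv y t := fun t ht =>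
    deriv_add (hx.1.1.1 t ht) (hy.1.1.1 t ht)
  refine ⟨⟨⟨fun t ht => (hx.1.1.1 t ht).add (hy.1.1.1 t ht), fun α β h1 h2 h3 => ?_⟩,
    hx.1.2.1.add hy.1.2.1, ?_⟩, ?_, ?_⟩
  · have h := (hx.1.1.2 α β h1 h2 h3).add (hy.1.1.2 α β h1 h2 h3)
    rw [absolutelyContinuousOnInterval_iff] at h ⊢
    intro ε hε
    obtain ⟨δ, hδ, h⟩ := h ε hε
    refine ⟨δ, hδ, fun E hE hlen => ?_⟩
    refine lt_of_eq_of_lt (Finset.sum_congr rfl fun i hi => ?_) (h E hE hlen)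
    have hsub : ∀ t ∈ uIcc α β, t ∈ Ioo (-a) a := fun t ht => by
      rw [uIcc_of_le h2] at ht
      exact ⟨h1.trans_le ht.1, ht.2.trans_lt h3⟩
    rw [hd _ (hsub _ (hE.1 i hi).1), hd _ (hsub _ (hE.1 i hi).2)]
    rfl
  · exact (memLp_congr_ae (formalL_add hx.1.1 hy.1.1)).2 (hx.1.2.2.add hy.1.2.2)
  · have := hx.2.1.add hy.2.1
    rw [add_zero] at this
    refine this.congr' ?_
    filter_upwards [Ioo_mem_nhdsGT (show -a < a by linarith)] with t ht
    rw [hd t ht]; ring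
  · have := hx.2.2.add hy.2.2
    rw [add_zero] at this
    refine this.congr' ?_
    filter_upwards [Ioo_mem_nhdsLT (show -a < a by linarith)] with t ht
    rw [hd t ht]; ring

lemma smul_mem_domainI {a : ℝ} (c : ℂ) {x : ℝ → ℂ} (hx : x ∈ domainI a) :
    c • x ∈ domainI a := by
  refine ⟨⟨⟨fun t ht => (hx.1.1.1 t ht).const_smul c, fun α β h1 h2 h3 => ?_⟩,
    hx.1.2.1.const_smul c, ?_⟩, ?_, ?_⟩
  · rw [deriv_smul_fun]
    exact (hx.1.1.2 α β h1 h2 h3).const_smul c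
  · rw [formalL_smul]; exact hx.1.2.2.const_smul c
  · have := hx.2.1.const_mul c
    rw [mul_zero] at this
    refine this.congr fun t => ?_
    simp only [deriv_smul_fun, Pi.smul_apply, smul_eq_mul]; ring
  · have := hx.2.2.const_mul c
    rw [mul_zero] at this
    refine this.congr fun t => ?_
    simp only [deriv_smul_fun, Pi.smul_apply, smul_eq_mul]; ring

/-! ### The operator `L_I` -/

/-- The graph of `L_I` in `L² × L²`: the pairs of classes of `x` and `L x`, for `x` in the
domain of `L_I`. -/
def graphI (a : ℝ) (ha : 0 < a) : Submodule ℂ (HilbertL2 a × HilbertL2 a) where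
  carrier := {fg | ∃ x ∈ domainI a,
    (fg.1 : ℝ → ℂ) =ᵐ[intervalMeasure a] x ∧ (fg.2 : ℝ → ℂ) =ᵐ[intervalMeasure a] formalL a x}
  zero_mem' := by
    refine ⟨0, zero_mem_domainI a, Lp.coeFn_zero _ _ _, ?_⟩
    have hL : formalL a 0 = 0 := by simpa using formalL_smul a 0 0
    rw [hL]; exact Lp.coeFn_zero _ _ _
  add_mem' := by
    rintro ⟨f, g⟩ ⟨f', g'⟩ ⟨x, hx, hf, hg⟩ ⟨y, hy, hf', hg'⟩
    exact ⟨x + y, add_mem_domainI ha hx hy, (Lp.coeFn_add f f').trans (hf.add hf'),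
      ((Lp.coeFn_add g g').trans (hg.add hg')).trans (formalL_add hx.1.1 hy.1.1).symm⟩
  smul_mem' := by
    rintro c ⟨f, g⟩ ⟨x, hx, hf, hg⟩
    refine ⟨c • x, smul_mem_domainI c hx, (Lp.coeFn_smul c f).trans (hf.const_smul c), ?_⟩
    rw [formalL_smul]
    exact (Lp.coeFn_smul c g).trans (hg.const_smul c)

/-- The graph is single valued. -/
lemma graphI_snd_eq_zero (a : ℝ) (ha : 0 < a) (p : HilbertL2 a × HilbertL2 a)
    (hp : p ∈ graphI a ha) (h0 : p.1 = 0) : p.2 = 0 := by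
  obtain ⟨x, hx, hf, hg⟩ := hp
  have hx0 : x =ᵐ[intervalMeasure a] 0 := by
    refine hf.symm.trans ?_
    rw [h0]; exact Lp.coeFn_zero _ _ _
  have hcont : ContinuousOn x (Ioo (-a) a) := fun t ht =>
    (hx.1.1.1 t ht).continuousAt.continuousWithinAt
  have hz : EqOn x 0 (Ioo (-a) a) :=
    Measure.eqOn_open_of_ae_eq hx0 isOpen_Ioo hcont continuousOn_const
  have hL0 : formalL a x =ᵐ[intervalMeasure a] 0 := by
    filter_upwards [ae_restrict_mem measurableSet_Ioo] with t ht
    have hfl : flux a x =ᶠ[𝓝 t] fun _ => 0 := by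
      filter_upwards [isOpen_Ioo.mem_nhds ht] with s hs
      have : x =ᶠ[𝓝 s] fun _ => 0 := by
        filter_upwards [isOpen_Ioo.mem_nhds hs] with r hr
        exact hz hr
      simp [flux, this.deriv_eq]
    simp [formalL, hfl.deriv_eq, hz ht]
  exact Lp.ext ((hg.trans hL0).trans (Lp.coeFn_zero _ _ _).symm)

/-- The operator `L_I` in `L²((-a, a))`: `L_I x = L x` for `x` in the domain of `L_I`. -/
def operatorI (a : ℝ) (ha : 0 < a) : HilbertL2 a →ₗ.[ℂ] HilbertL2 a :=
  (graphI a ha).toLinearPMap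

/-- The operator `L_I` has the intended graph. -/
lemma operatorI_graph (a : ℝ) (ha : 0 < a) : (operatorI a ha).graph = graphI a ha :=
  Submodule.toLinearPMap_graph_eq _ (graphI_snd_eq_zero a ha)

/-! ### The boundary value problem -/

/-- `e` solves `L e = z e` on `(-a, a)` and has finite limits at both endpoints. -/
structure IsFiniteSolution (a : ℝ) (z : ℂ) (e : ℝ → ℂ) : Prop where
  differentiableAt : ∀ t ∈ Ioo (-a) a, DifferentiableAt ℝ e t
  differentiableAt_deriv : ∀ t ∈ Ioo (-a) a, DifferentiableAt ℝ (deriv e) t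
  equation : ∀ t ∈ Ioo (-a) a, formalL a e t = z * e t
  finite_left : ∃ c : ℂ, Tendsto e (𝓝[>] (-a)) (𝓝 c)
  finite_right : ∃ c : ℂ, Tendsto e (𝓝[<] a) (𝓝 c)

end Prolate

end

/-!
Write `p(t) = 1 - t² / a²`. If `w` is square integrable with mean zero, `(p x')' = w` has, up to a
constant, exactly one solution whose flux `p x'` vanishes at both endpoints: `x' = p⁻¹ ∫ w`. By the
Cauchy–Schwarz inequality `|x'|` is at most `‖w‖` times an integrable function, so by
Arzelà–Ascoli the solution depends compactly on `w`. Extended to the constants, this inverts the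
operator up to a compact error, and since its quadratic form `∫ p |x'|² + ∫ t² |x|²` is positive,
the Fredholm alternative yields a compact symmetric inverse, from which self-adjointness and the
structure of the spectrum follow. A nonzero boundary value of the flux would make `x` grow like
`log (a - |t|)`, so finite limits are equivalent to the boundary conditions. For two solutions of
`L x = z x` the Wronskian is constant and vanishes at the endpoints, so eigenvalues are simple.
-/

namespace Prolate

section Inverse

variable {E : Type*} [NormedAddCommGroup E] [NormedSpace ℂ E] {A : E →ₗ.[ℂ] E} {R : E →L[ℂ] E}

/-- `R` is the everywhere defined bounded inverse of the unbounded operator `A`. -/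
structure IsInverse (A : E →ₗ.[ℂ] E) (R : E →L[ℂ] E) : Prop where
  apply_inv : ∀ f, ∃ h : R f ∈ A.domain, A ⟨R f, h⟩ = f
  inv_apply : ∀ x : A.domain, R (A x) = x

namespace IsInverse

lemma injective (h : IsInverse A R) : Function.Injective R := by
  refine (injective_iff_map_eq_zero R).2 fun f hf => ?_
  obtain ⟨hd, he⟩ := h.apply_inv f
  rw [← he, show (⟨R f, hd⟩ : A.domain) = 0 from Subtype.ext hf, A.map_zero]

lemma eigenspace_eq (h : IsInverse A R) {z : ℂ} (hz : z ≠ 0) :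
    eigenspace A z = Module.End.eigenspace (R : Module.End ℂ E) z⁻¹ := by
  ext f
  rw [Module.End.mem_eigenspace_iff, ContinuousLinearMap.coe_coe, eq_inv_smul_iff₀ hz, ← map_smul]
  constructor
  · rintro ⟨hf, he⟩
    rw [← he, h.inv_apply]
  · intro hf
    obtain ⟨hd, he⟩ := h.apply_inv (z • f)
    exact ⟨hf ▸ hd, by simpa only [hf] using he⟩

lemma hasEigenvalue_iff (h : IsInverse A R) {z : ℂ} (hz : z ≠ 0) :
    HasEigenvalue A z ↔ Module.End.HasEigenvalue (R : Module.End ℂ E) z⁻¹ := by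
  rw [Module.End.hasEigenvalue_iff, ← h.eigenspace_eq hz, Submodule.ne_bot_iff]
  rfl

lemma zero_mem_resolventSet (h : IsInverse A R) : (0 : ℂ) ∈ resolventSet A := by
  refine ⟨R, fun f => ?_, fun x => by rw [zero_smul, sub_zero, h.inv_apply]⟩
  obtain ⟨hd, he⟩ := h.apply_inv f
  exact ⟨hd, by rw [he, zero_smul, sub_zero]⟩

-- `(A - z)⁻¹ = z⁻¹ R (z⁻¹ - R)⁻¹`, because `A - z = z (z⁻¹ - R) A`.
lemma mem_resolventSet (h : IsInverse A R) {z : ℂ} (hz : z ≠ 0)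
    (hR : z⁻¹ ∈ _root_.resolventSet ℂ R) : z ∈ resolventSet A := by
  obtain ⟨u, hu⟩ := _root_.spectrum.mem_resolventSet_iff.1 hR
  set S : E →L[ℂ] E := ↑u⁻¹
  have hu_apply : ∀ f, (u : E →L[ℂ] E) f = z⁻¹ • f - R f := fun f => by
    simp [hu, Algebra.algebraMap_eq_smul_one]
  have right_inv : ∀ f, z⁻¹ • S f - R (S f) = f := fun f => by
    rw [← hu_apply]
    exact DFunLike.congr_fun u.mul_inv f
  have left_inv : ∀ f, S (z⁻¹ • f - R f) = f := fun f => by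
    rw [← hu_apply]
    exact DFunLike.congr_fun u.inv_mul f
  have comm : ∀ f, R (S f) = S (R f) := fun f => by
    conv_rhs => rw [← right_inv f, map_sub, map_smul, left_inv]
  refine ⟨z⁻¹ • (R ∘L S), fun f => ?_, fun x => ?_⟩
  · obtain ⟨hd, he⟩ := h.apply_inv (S f)
    have hd' : z⁻¹ • R (S f) ∈ A.domain := A.domain.smul_mem _ hd
    have hA : A ⟨z⁻¹ • R (S f), hd'⟩ = z⁻¹ • S f :=
      (A.map_smul z⁻¹ ⟨R (S f), hd⟩).trans (by rw [he])
    refine ⟨hd', ?_⟩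
    change A ⟨z⁻¹ • R (S f), hd'⟩ - z • z⁻¹ • R (S f) = f
    rw [hA, smul_inv_smul₀ hz, right_inv]
  · calc z⁻¹ • R (S (A x - z • (x : E))) = S (z⁻¹ • (x : E) - R x) := by
          rw [comm, map_sub R, h.inv_apply, map_smul R, ← map_smul S, smul_sub,
            inv_smul_smul₀ hz]
      _ = x := left_inv x

end IsInverse

lemma HasEigenvalue.mem_spectrum {z : ℂ} (hz : HasEigenvalue A z) : z ∈ spectrum A := by
  obtain ⟨f, ⟨hf, he⟩, hf0⟩ := hz
  rintro ⟨S, -, hS⟩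
  have := hS ⟨f, hf⟩
  rw [he, sub_self, map_zero] at this
  exact hf0 this.symm

lemma IsInverse.mem_spectrum_iff [CompleteSpace E] (h : IsInverse A R) (hR : IsCompactOperator R)
    {z : ℂ} : z ∈ spectrum A ↔ HasEigenvalue A z := by
  refine ⟨fun hz => ?_, HasEigenvalue.mem_spectrum⟩
  have hz0 : z ≠ 0 := by
    rintro rfl
    exact hz h.zero_mem_resolventSet
  exact (h.hasEigenvalue_iff hz0).2 <|
    (hR.hasEigenvalue_or_mem_resolventSet (inv_ne_zero hz0)).resolve_right
      fun hr => hz (h.mem_resolventSet hz0 hr)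

lemma isUnit_one_add_of_injective [CompleteSpace E] {C : E →L[ℂ] E} (hC : IsCompactOperator C)
    (hinj : ∀ f, f + C f = 0 → f = 0) : IsUnit (1 + C) := by
  have hne : ¬ Module.End.HasEigenvalue (C : Module.End ℂ E) (-1) := fun h => by
    obtain ⟨f, hf, hf0⟩ := h.exists_hasEigenvector
    rw [Module.End.mem_eigenspace_iff, neg_one_smul, ContinuousLinearMap.coe_coe] at hf
    exact hf0 (hinj f (by rw [hf, add_neg_cancel]))
  have hres := (hC.hasEigenvalue_or_mem_resolventSet (neg_ne_zero.2 one_ne_zero)).resolve_left hne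
  rw [_root_.spectrum.mem_resolventSet_iff, ← IsUnit.neg_iff] at hres
  convert hres using 1
  simp [add_comm]

-- A compact right parametrix of an injective operator can be corrected to an inverse: by the
-- Fredholm alternative `1 + C` is invertible, and `R = S (1 + C)⁻¹`.
lemma exists_compact_isInverse [CompleteSpace E] {S C : E →L[ℂ] E}
    (hA : ∀ x : A.domain, A x = 0 → x = 0) (hS : IsCompactOperator S) (hC : IsCompactOperator C)
    (hSinj : ∀ g, S g = 0 → g = 0)
    (hAS : ∀ g, ∃ h : S g ∈ A.domain, A ⟨S g, h⟩ = g + C g) :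
    ∃ R : E →L[ℂ] E, IsCompactOperator R ∧ IsInverse A R := by
  have hunit : IsUnit (1 + C) := isUnit_one_add_of_injective hC fun g hg => by
    obtain ⟨hd, he⟩ := hAS g
    exact hSinj g (congrArg Subtype.val (hA _ (he.trans hg)))
  obtain ⟨u, hu⟩ := hunit
  have hAR : ∀ f, ∃ h : (S ∘L ↑u⁻¹) f ∈ A.domain, A ⟨(S ∘L ↑u⁻¹) f, h⟩ = f := fun f => by
    obtain ⟨hd, he⟩ := hAS ((↑u⁻¹ : E →L[ℂ] E) f)
    refine ⟨hd, he.trans ?_⟩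
    have := DFunLike.congr_fun u.mul_inv f
    rwa [hu] at this
  refine ⟨S ∘L ↑u⁻¹, hS.comp_clm _, hAR, fun x => ?_⟩
  obtain ⟨hd, he⟩ := hAR (A x)
  exact congrArg Subtype.val (sub_eq_zero.1 (hA (⟨_, hd⟩ - x) (by rw [A.map_sub, he, sub_self])))

lemma exists_ne_norm_map_sub_lt {T : E →L[ℂ] E} (hT : IsCompactOperator T) {u : ℕ → E}
    (hu : ∀ n, ‖u n‖ ≤ 1) {ε : ℝ} (hε : 0 < ε) : ∃ m n, m ≠ n ∧ ‖T (u m) - T (u n)‖ < ε := by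
  obtain ⟨K, hK, hTK⟩ := hT.image_closedBall_subset_compact (f := (T : E →ₗ[ℂ] E)) 1
  obtain ⟨y, -, ψ, hψ, hlim⟩ :=
    hK.tendsto_subseq fun n => hTK ⟨u n, mem_closedBall_zero_iff.2 (hu n), rfl⟩
  obtain ⟨N, hN⟩ := Metric.cauchySeq_iff'.1 hlim.cauchySeq ε hε
  refine ⟨ψ (N + 1), ψ N, hψ.injective.ne N.succ_ne_self, ?_⟩
  rw [← dist_eq_norm]
  exact hN (N + 1) N.le_succ

end Inverse

section PositiveForm

variable {H : Type*} [NormedAddCommGroup H] [InnerProductSpace ℂ H]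
  {A : H →ₗ.[ℂ] H} {R : H →L[ℂ] H}

/-- The quadratic form `⟪x, A x⟫` of `A` is real and strictly positive for `x ≠ 0`. -/
def HasPositiveForm (A : H →ₗ.[ℂ] H) : Prop :=
  ∀ x : A.domain, (x : H) ≠ 0 → ∃ r : ℝ, 0 < r ∧ inner ℂ (x : H) (A x) = r

lemma HasPositiveForm.eq_zero_of_apply_eq_zero (hA : HasPositiveForm A) (x : A.domain)
    (hx : A x = 0) : x = 0 := by
  by_contra hne
  obtain ⟨r, hr, hxr⟩ := hA x fun h => hne (Subtype.ext h)
  rw [hx, inner_zero_right] at hxr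
  exact hr.ne (Complex.ofReal_injective hxr)

lemma HasPositiveForm.eigenvalue_pos (hA : HasPositiveForm A) {z : ℂ} (hz : HasEigenvalue A z) :
    ∃ r : ℝ, 0 < r ∧ z = r := by
  obtain ⟨f, ⟨hf, he⟩, hf0⟩ := hz
  obtain ⟨r, hr, hfr⟩ := hA ⟨f, hf⟩ hf0
  have hnorm : 0 < ‖f‖ := norm_pos_iff.2 hf0
  rw [he, inner_smul_right, inner_self_eq_norm_sq_to_K] at hfr
  refine ⟨r / ‖f‖ ^ 2, by positivity, ?_⟩
  rw [Complex.ofReal_div, eq_div_iff (by exact_mod_cast (pow_pos hnorm 2).ne'), ← hfr]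
  simp

namespace IsInverse

lemma finiteDimensional_eigenspace [CompleteSpace H] (h : IsInverse A R) (hR : IsCompactOperator R)
    {z : ℂ} (hz : z ≠ 0) : FiniteDimensional ℂ (eigenspace A z) := by
  rw [h.eigenspace_eq hz]
  exact ContinuousLinearMap.finite_dimensional_eigenspace hR _ (inv_ne_zero hz)

lemma isSymmetric (h : IsInverse A R) (hA : HasPositiveForm A) : R.IsSymmetric := by
  refine (LinearMap.isSymmetric_iff_inner_map_self_real _).2 fun f => ?_
  obtain ⟨hd, he⟩ := h.apply_inv f
  by_cases hRf : R f = 0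
  · simp [hRf]
  · obtain ⟨r, -, hr⟩ := hA ⟨R f, hd⟩ hRf
    rw [he] at hr
    rw [ContinuousLinearMap.coe_coe, hr, Complex.conj_ofReal]

lemma dense_domain [CompleteSpace H] (h : IsInverse A R) (hR : R.IsSymmetric) :
    Dense (A.domain : Set H) := by
  rw [Submodule.dense_iff_topologicalClosure_eq_top,
    Submodule.topologicalClosure_eq_top_iff, Submodule.eq_bot_iff]
  refine fun f hf => h.injective (ext_inner_left ℂ fun g => ?_)
  rw [map_zero, inner_zero_right]
  exact (hR g f).symm.trans ((Submodule.mem_orthogonal _ _).1 hf (R g) (h.apply_inv g).1)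

lemma isSelfAdjoint [CompleteSpace H] (h : IsInverse A R) (hR : R.IsSymmetric) :
    IsSelfAdjoint A := by
  have hdense := h.dense_domain hR
  have hformal : A.IsFormalAdjoint A := fun x y => by
    conv_lhs => rw [← h.inv_apply y]
    conv_rhs => rw [← h.inv_apply x]
    exact (hR (A x) (A y)).symm
  have hle := hformal.le_adjoint hdense
  rw [LinearPMap.isSelfAdjoint_def]
  refine (LinearPMap.eq_of_le_of_domain_eq hle (le_antisymm hle.1 fun y hy => ?_)).symm
  have hy_eq : y = R (A.adjoint ⟨y, hy⟩) := ext_inner_right ℂ fun f => by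
    obtain ⟨hd, he⟩ := h.apply_inv f
    have := LinearPMap.adjoint_isFormalAdjoint hdense ⟨y, hy⟩ ⟨R f, hd⟩
    rw [he] at this
    exact this.symm.trans (hR _ _).symm
  rw [hy_eq]
  exact (h.apply_inv _).1

lemma inv_le_norm_sub (h : IsInverse A R) (hR : R.IsSymmetric) {r s M : ℝ} (hr : 0 < r)
    (hrM : r ≤ M) (hs : 0 < s) (hrs : r ≠ s) {f g : H} (hf : f ∈ eigenspace A r)
    (hg : g ∈ eigenspace A s) (hf1 : ‖f‖ = 1) : M⁻¹ ≤ ‖R f - R g‖ := by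
  rw [h.eigenspace_eq (by exact_mod_cast hr.ne')] at hf
  rw [h.eigenspace_eq (by exact_mod_cast hs.ne')] at hg
  have horth : inner ℂ f g = 0 :=
    hR.orthogonalFamily_eigenspaces (i := (r : ℂ)⁻¹) (j := (s : ℂ)⁻¹)
      (fun he => hrs (by exact_mod_cast inv_inj.1 he)) ⟨f, hf⟩ ⟨g, hg⟩
  have hRf : R f = (r : ℂ)⁻¹ • f := Module.End.mem_eigenspace_iff.1 hf
  have hRg : R g = (s : ℂ)⁻¹ • g := Module.End.mem_eigenspace_iff.1 hg
  have hRorth : inner ℂ (R f) (R g) = 0 := by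
    rw [hRf, hRg, inner_smul_left, inner_smul_right, horth, mul_zero, mul_zero]
  calc M⁻¹ ≤ ‖R f‖ := by
        rw [hRf, norm_smul, hf1, mul_one, norm_inv, Complex.norm_real, Real.norm_of_nonneg hr.le]
        exact inv_anti₀ hr hrM
    _ ≤ ‖R f - R g‖ := by
        refine le_of_sq_le_sq ?_ (norm_nonneg _)
        rw [@norm_sub_sq ℂ, hRorth]
        simp

lemma finite_eigenvalues_le (h : IsInverse A R) (hR : IsCompactOperator R)
    (hA : HasPositiveForm A) (M : ℝ) : ({r : ℝ | HasEigenvalue A r} ∩ Iic M).Finite := by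
  by_contra hinf
  have : Infinite ↥({r : ℝ | HasEigenvalue A r} ∩ Iic M) := Set.infinite_coe_iff.2 hinf
  let ν := Infinite.natEmbedding ↥({r : ℝ | HasEigenvalue A r} ∩ Iic M)
  have hν : ∀ n, 0 < (ν n : ℝ) := fun n => by
    obtain ⟨r, hr, hνr⟩ := hA.eigenvalue_pos (ν n).2.1
    rwa [Complex.ofReal_injective hνr]
  have hex : ∀ n, ∃ e ∈ eigenspace A (ν n : ℝ), ‖e‖ = 1 := fun n => by
    obtain ⟨f, hf, hf0⟩ := (ν n).2.1
    exact ⟨(‖f‖⁻¹ : ℂ) • f, Submodule.smul_mem _ _ hf, norm_smul_inv_norm hf0⟩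
  choose e he hnorm using hex
  obtain ⟨m, n, hmn, hlt⟩ := exists_ne_norm_map_sub_lt hR (fun n => (hnorm n).le)
    (inv_pos.2 ((hν 0).trans_le (ν 0).2.2))
  exact hlt.not_ge <| h.inv_le_norm_sub (h.isSymmetric hA) (hν m) (ν m).2.2 (hν n)
    (fun heq => hmn (ν.injective (Subtype.ext heq))) (he m) (he n) (hnorm m)

lemma hasDiscreteSpectrum [CompleteSpace H] (h : IsInverse A R) (hR : IsCompactOperator R)
    (hA : HasPositiveForm A) : HasDiscreteSpectrum A := by
  intro z hz
  have hzev := (h.mem_spectrum_iff hR).1 hz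
  obtain ⟨r, hr, rfl⟩ := hA.eigenvalue_pos hzev
  refine ⟨?_, hzev, h.finiteDimensional_eigenspace hR (by exact_mod_cast hr.ne')⟩
  have hfin : (({s : ℝ | HasEigenvalue A s} ∩ Iic (r + 1)) \ {r}).Finite :=
    (h.finite_eigenvalues_le hR hA (r + 1)).subset sdiff_subset
  obtain ⟨ε, hε, hball⟩ := Metric.isOpen_iff.1 hfin.isClosed.isOpen_compl r (by simp)
  refine ⟨min ε 1, by positivity, fun w hw hwz => ?_⟩
  have hwev := (h.mem_spectrum_iff hR).1 hw
  obtain ⟨s, -, rfl⟩ := hA.eigenvalue_pos hwev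
  rw [Complex.dist_of_im_eq (by simp), Complex.ofReal_re, Complex.ofReal_re, lt_min_iff] at hwz
  by_contra hne
  refine hball hwz.1 ⟨⟨hwev, ?_⟩, fun hsr => hne (by rw [mem_singleton_iff.1 hsr])⟩
  rw [Real.dist_eq] at hwz
  exact mem_Iic.2 (by linarith [(abs_lt.1 hwz.2).2])

lemma iSup_eigenspace_le (h : IsInverse A R) (hA : HasPositiveForm A) :
    ⨆ μ, Module.End.eigenspace (R : Module.End ℂ H) μ ≤
      ⨆ r : {r : ℝ | HasEigenvalue A r}, eigenspace A (r : ℝ) := by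
  refine iSup_le fun μ => ?_
  by_cases hμ : Module.End.HasEigenvalue (R : Module.End ℂ H) μ
  · have hμ0 : μ ≠ 0 := by
      rintro rfl
      obtain ⟨f, hf, hf0⟩ := hμ.exists_hasEigenvector
      rw [Module.End.mem_eigenspace_iff, zero_smul] at hf
      exact hf0 (h.injective (hf.trans (map_zero R).symm))
    have hev : HasEigenvalue A μ⁻¹ :=
      (h.hasEigenvalue_iff (inv_ne_zero hμ0)).2 (by rwa [inv_inv])
    obtain ⟨r, -, hr⟩ := hA.eigenvalue_pos hev
    rw [← inv_inv μ, ← h.eigenspace_eq (inv_ne_zero hμ0), hr]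
    exact le_iSup (fun r : {r : ℝ | HasEigenvalue A r} => eigenspace A (r : ℝ))
      ⟨r, by rwa [hr] at hev⟩
  · rw [Module.End.hasEigenvalue_iff, not_not] at hμ
    exact hμ.trans_le bot_le

lemma infinite_eigenvalues [CompleteSpace H] (h : IsInverse A R) (hR : IsCompactOperator R)
    (hA : HasPositiveForm A) (hH : ¬ FiniteDimensional ℂ H) :
    {r : ℝ | HasEigenvalue A r}.Infinite := by
  intro hfin
  let V : Submodule ℂ H := ⨆ r : {r : ℝ | HasEigenvalue A r}, eigenspace A (r : ℝ)
  have hV : FiniteDimensional ℂ V := by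
    have := hfin.to_subtype
    have (r : {r : ℝ | HasEigenvalue A r}) : FiniteDimensional ℂ (eigenspace A (r : ℝ)) := by
      obtain ⟨s, hs, hrs⟩ := hA.eigenvalue_pos r.2
      exact h.finiteDimensional_eigenspace hR (by rw [hrs]; exact_mod_cast hs.ne')
    exact Submodule.finiteDimensional_iSup _
  have hVperp : Vᗮ = ⊥ := by
    rw [eq_bot_iff, ← ContinuousLinearMap.orthogonalComplement_iSup_eigenspaces_eq_bot hR
      (h.isSymmetric hA)]
    exact Submodule.orthogonal_le (h.iSup_eigenspace_le hA)
  rw [Submodule.orthogonal_eq_bot_iff.1 hVperp] at hV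
  exact hH (Module.Finite.equiv Submodule.topEquiv)

end IsInverse

end PositiveForm

lemma nonempty_orderIso_nat {α : Type*} [LinearOrder α] [Infinite α]
    (hfin : ∀ x : α, (Iic x).Finite) : Nonempty (α ≃o ℕ) := by
  let _ : LocallyFiniteOrder α :=
    LocallyFiniteOrder.ofFiniteIcc fun x y => (hfin y).subset Icc_subset_Iic_self
  obtain ⟨x₀⟩ := (inferInstance : Nonempty α)
  obtain ⟨b, hb, hmin⟩ := (hfin x₀).exists_minimalFor id _ ⟨x₀, le_rfl⟩
  let _ : OrderBot α :=
    { bot := b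
      bot_le := fun x => (le_total x b).elim (fun hx => hmin (hx.trans hb) hx) id }
  have _ : NoMaxOrder α := ⟨fun x => by
    by_contra! hmax
    exact infinite_univ ((hfin x).subset fun y _ => hmax y)⟩
  let _ := LinearLocallyFiniteOrder.succOrder α
  let _ := LinearLocallyFiniteOrder.predOrder α
  exact ⟨orderIsoNatOfLinearSuccPredArch⟩

lemma exists_strictMono_range_eq {S : Set ℝ} (hinf : S.Infinite)
    (hfin : ∀ M, (S ∩ Iic M).Finite) :
    ∃ μ : ℕ → ℝ, StrictMono μ ∧ range μ = S ∧ Tendsto μ atTop atTop := by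
  have := hinf.to_subtype
  obtain ⟨e⟩ := nonempty_orderIso_nat fun x : S =>
    Set.Finite.of_finite_image ((hfin x).subset (by rintro _ ⟨s, hs, rfl⟩; exact ⟨s.2, hs⟩))
      Subtype.val_injective.injOn
  have hmono : StrictMono fun n => (e.symm n : ℝ) := fun m n hmn => e.symm.strictMono hmn
  refine ⟨fun n => e.symm n, hmono, ?_, ?_⟩
  · exact (e.symm.surjective.range_comp Subtype.val).trans Subtype.range_coe
  · refine tendsto_atTop.2 fun M => ?_
    rw [← Nat.cofinite_eq_atTop]
    refine Set.Finite.of_finite_image ((hfin M).subset ?_) hmono.injective.injOn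
    rintro _ ⟨n, hn, rfl⟩
    exact ⟨(e.symm n).2, (not_le.1 (show ¬ M ≤ (e.symm n : ℝ) from hn)).le⟩

lemma IsInverse.exists_spectrum_eq_range {H : Type*} [NormedAddCommGroup H]
    [InnerProductSpace ℂ H] [CompleteSpace H] {A : H →ₗ.[ℂ] H} {R : H →L[ℂ] H}
    (h : IsInverse A R) (hR : IsCompactOperator R) (hA : HasPositiveForm A)
    (hH : ¬ FiniteDimensional ℂ H) :
    ∃ μ : ℕ → ℝ, StrictMono μ ∧ (∀ n, 0 < μ n) ∧ Tendsto μ atTop atTop ∧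
      spectrum A = range fun n => (μ n : ℂ) := by
  obtain ⟨μ, hmono, hrange, htop⟩ :=
    exists_strictMono_range_eq (h.infinite_eigenvalues hR hA hH) (h.finite_eigenvalues_le hR hA)
  have hμ : ∀ n, HasEigenvalue A (μ n) := fun n => hrange.subset ⟨n, rfl⟩
  refine ⟨μ, hmono, fun n => ?_, htop, Subset.antisymm (fun z hz => ?_) ?_⟩
  · obtain ⟨r, hr, hμr⟩ := hA.eigenvalue_pos (hμ n)
    rwa [Complex.ofReal_injective hμr]
  · have hzev := (h.mem_spectrum_iff hR).1 hz
    obtain ⟨r, -, rfl⟩ := hA.eigenvalue_pos hzev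
    obtain ⟨n, rfl⟩ := hrange.superset hzev
    exact ⟨n, rfl⟩
  · rintro _ ⟨n, rfl⟩
    exact (hμ n).mem_spectrum

section AbsolutelyContinuous

variable {X Y F : Type*} [PseudoMetricSpace X] [PseudoMetricSpace Y] [NormedAddCommGroup F]
  [NormedSpace ℝ F] {α β : ℝ}

lemma absolutelyContinuousOnInterval_of_dist_le {f : ℝ → X} {g : ℝ → Y}
    (hg : AbsolutelyContinuousOnInterval g α β)
    (h : ∀ s ∈ uIcc α β, ∀ t ∈ uIcc α β, dist (f s) (f t) ≤ dist (g s) (g t)) :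
    AbsolutelyContinuousOnInterval f α β := by
  rw [absolutelyContinuousOnInterval_iff] at hg ⊢
  intro ε hε
  obtain ⟨δ, hδ, hg⟩ := hg ε hε
  exact ⟨δ, hδ, fun I hI hlen => (Finset.sum_le_sum fun i hi =>
    h _ (hI.1 i hi).1 _ (hI.1 i hi).2).trans_lt (hg I hI hlen)⟩

lemma absolutelyContinuousOnInterval_integral {f : ℝ → F} {c : ℝ}
    (hf : IntervalIntegrable f volume α β) (hc : c ∈ uIcc α β) :
    AbsolutelyContinuousOnInterval (fun t => ∫ s in c..t, f s) α β := by
  have hintegrable : ∀ t ∈ uIcc α β, IntervalIntegrable f volume c t := fun t ht =>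
    hf.mono_set (uIcc_subset_uIcc hc ht)
  refine absolutelyContinuousOnInterval_of_dist_le
    (hf.norm.absolutelyContinuousOnInterval_intervalIntegral hc) fun s hs t ht => ?_
  rw [dist_eq_norm, Real.dist_eq,
    intervalIntegral.integral_interval_sub_left (hintegrable s hs) (hintegrable t ht),
    intervalIntegral.integral_interval_sub_left (hintegrable s hs).norm (hintegrable t ht).norm]
  exact intervalIntegral.norm_integral_le_abs_integral_norm

lemma integral_eq_sub_of_absolutelyContinuous [CompleteSpace F] {f f' : ℝ → F}
    (hf : AbsolutelyContinuousOnInterval f α β) (hf' : IntervalIntegrable f' volume α β)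
    (h : ∀ᵐ t, t ∈ uIcc α β → HasDerivAt f (f' t) t) :
    ∫ t in α..β, f' t = f β - f α := by
  have hsub := hf.sub (absolutelyContinuousOnInterval_integral hf' left_mem_uIcc)
  obtain ⟨C, hC⟩ := hsub.const_of_ae_hasDerivAt_zero (by
    filter_upwards [h, hf'.ae_hasDerivAt_integral] with t h1 h2 ht
    simpa using (h1 ht).sub (h2 ht α left_mem_uIcc))
  have hα := hC α left_mem_uIcc
  have hβ := hC β right_mem_uIcc
  simp only [Pi.sub_apply, intervalIntegral.integral_same, sub_zero] at hα hβ
  rw [hα, ← hβ, sub_sub_cancel]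

end AbsolutelyContinuous

section Primitive

variable {a : ℝ} {w v : ℝ → ℂ} {s t : ℝ}

/-- The weight `p(t) = 1 - t² / a²` of the differential expression. -/
noncomputable def weight (a t : ℝ) : ℝ := 1 - t ^ 2 / a ^ 2

lemma weight_eq (ha : a ≠ 0) (t : ℝ) : weight a t = (a + t) * (a - t) / a ^ 2 := by
  rw [weight]
  field_simp
  ring

lemma weight_pos (ht : t ∈ Ioo (-a) a) : 0 < weight a t := by
  have ha : 0 < a := by linarith [ht.1, ht.2]
  rw [weight_eq ha.ne']
  exact div_pos (mul_pos (by linarith [ht.1]) (by linarith [ht.2])) (by positivity)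

lemma weight_ne_zero (ht : t ∈ Ioo (-a) a) : (weight a t : ℂ) ≠ 0 :=
  Complex.ofReal_ne_zero.2 (weight_pos ht).ne'

lemma flux_eq_weight_mul (a : ℝ) (x : ℝ → ℂ) (t : ℝ) :
    flux a x t = (weight a t : ℂ) * deriv x t := rfl

lemma deriv_eq_flux_div_weight (x : ℝ → ℂ) (ht : t ∈ Ioo (-a) a) :
    deriv x t = flux a x t / weight a t := by
  rw [flux_eq_weight_mul, mul_div_cancel_left₀ _ (weight_ne_zero ht)]

lemma contDiff_weight (a : ℝ) : ContDiff ℝ 1 (fun t => (weight a t : ℂ)) := by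
  unfold weight
  exact Complex.ofRealCLM.contDiff.comp
    (contDiff_const.sub ((contDiff_id.pow 2).div_const (a ^ 2)))

lemma uIcc_subset_Icc (hs : s ∈ Icc (-a) a) (ht : t ∈ Icc (-a) a) : uIcc s t ⊆ Icc (-a) a :=
  OrdConnected.uIcc_subset ordConnected_Icc hs ht

lemma intervalIntegrable_of_mem_Icc {F : Type*} [NormedAddCommGroup F] {f : ℝ → F}
    (hf : IntervalIntegrable f volume (-a) a) (hs : s ∈ Icc (-a) a) (ht : t ∈ Icc (-a) a) :
    IntervalIntegrable f volume s t :=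
  hf.mono_set (by rw [uIcc_of_le (hs.1.trans hs.2)]; exact uIcc_subset_Icc hs ht)

lemma intervalIntegrable_of_memLp (ha : 0 < a) (hw : MemLp w 2 (intervalMeasure a)) :
    IntervalIntegrable w volume (-a) a := by
  rw [intervalIntegrable_iff_integrableOn_Ioo_of_le (by linarith)]
  exact hw.integrable one_le_two

lemma norm_integral_le_sqrt_mul (hw : MemLp w 2 (intervalMeasure a)) (hs : s ∈ Icc (-a) a)
    (ht : t ∈ Icc (-a) a) (hst : s ≤ t) :
    ‖∫ r in s..t, w r‖ ≤ √(t - s) * (eLpNorm w 2 (intervalMeasure a)).toReal := by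
  have hle : volume.restrict (Ioo s t) ≤ intervalMeasure a :=
    Measure.restrict_mono (Ioo_subset_Ioo hs.1 ht.2) le_rfl
  have hbound : ‖∫ r in s..t, w r‖ₑ ≤
      eLpNorm w 2 (intervalMeasure a) * ENNReal.ofReal (t - s) ^ (1 / 2 : ℝ) :=
    calc ‖∫ r in s..t, w r‖ₑ ≤ eLpNorm w 1 (volume.restrict (Ioo s t)) := by
          rw [intervalIntegral.integral_of_le hst, integral_Ioc_eq_integral_Ioo,
            eLpNorm_one_eq_lintegral_enorm]
          exact enorm_integral_le_lintegral_enorm _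
      _ ≤ eLpNorm w 2 (volume.restrict (Ioo s t)) * ENNReal.ofReal (t - s) ^ (1 / 2 : ℝ) := by
          have := eLpNorm_le_eLpNorm_mul_rpow_measure_univ one_le_two (hw.1.mono_measure hle)
          rw [Measure.restrict_apply_univ, Real.volume_Ioo] at this
          convert this using 2
          norm_num
      _ ≤ _ := by gcongr
  have hreal := ENNReal.toReal_mono (ENNReal.mul_ne_top hw.2.ne
    (ENNReal.rpow_ne_top_of_nonneg (by norm_num) ENNReal.ofReal_ne_top)) hbound
  rwa [toReal_enorm, ENNReal.toReal_mul, ← ENNReal.toReal_rpow,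
    ENNReal.toReal_ofReal (sub_nonneg.2 hst), mul_comm, ← Real.sqrt_eq_rpow] at hreal

/-- The primitive of `w` that vanishes at `-a`. -/
noncomputable def primitive (a : ℝ) (w : ℝ → ℂ) (t : ℝ) : ℂ := ∫ s in (-a)..t, w s

lemma primitive_left (a : ℝ) (w : ℝ → ℂ) : primitive a w (-a) = 0 :=
  intervalIntegral.integral_same

lemma primitive_congr_ae (h : w =ᵐ[intervalMeasure a] v) (ht : t ∈ Icc (-a) a) :
    primitive a w t = primitive a v t := by
  rw [primitive, primitive, intervalIntegral.integral_of_le ht.1,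
    intervalIntegral.integral_of_le ht.1, integral_Ioc_eq_integral_Ioo,
    integral_Ioc_eq_integral_Ioo]
  exact integral_congr_ae (ae_restrict_of_ae_restrict_of_subset (Ioo_subset_Ioo_right ht.2) h)

lemma primitive_add (hw : IntervalIntegrable w volume (-a) a)
    (hv : IntervalIntegrable v volume (-a) a) (ht : t ∈ Icc (-a) a) :
    primitive a (w + v) t = primitive a w t + primitive a v t :=
  have ha : -a ∈ Icc (-a) a := ⟨le_rfl, ht.1.trans ht.2⟩
  intervalIntegral.integral_add (intervalIntegrable_of_mem_Icc hw ha ht)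
    (intervalIntegrable_of_mem_Icc hv ha ht)

lemma primitive_smul (a : ℝ) (c : ℂ) (w : ℝ → ℂ) (t : ℝ) :
    primitive a (c • w) t = c * primitive a w t :=
  intervalIntegral.integral_smul c w

lemma primitive_add_integral (hw : IntervalIntegrable w volume (-a) a) (ht : t ∈ Icc (-a) a) :
    primitive a w t + ∫ s in t..a, w s = primitive a w a :=
  intervalIntegral.integral_add_adjacent_intervals
    (intervalIntegrable_of_mem_Icc hw ⟨le_rfl, ht.1.trans ht.2⟩ ht)
    (intervalIntegrable_of_mem_Icc hw ht ⟨ht.1.trans ht.2, le_rfl⟩)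

lemma absolutelyContinuousOnInterval_primitive (hw : IntervalIntegrable w volume (-a) a) :
    AbsolutelyContinuousOnInterval (primitive a w) (-a) a :=
  absolutelyContinuousOnInterval_integral hw left_mem_uIcc

lemma continuousOn_primitive (ha : 0 < a) (hw : IntervalIntegrable w volume (-a) a) :
    ContinuousOn (primitive a w) (Icc (-a) a) := by
  rw [← uIcc_of_le (by linarith : -a ≤ a)]
  exact (absolutelyContinuousOnInterval_primitive hw).continuousOn

lemma tendsto_left_of_continuousOn {f : ℝ → ℂ} (ha : 0 < a) (hf : ContinuousOn f (Icc (-a) a)) :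
    Tendsto f (𝓝[>] (-a)) (𝓝 (f (-a))) := by
  rw [← nhdsWithin_Ioo_eq_nhdsGT (by linarith : -a < a)]
  exact (hf (-a) ⟨le_rfl, by linarith⟩).mono Ioo_subset_Icc_self

lemma tendsto_right_of_continuousOn {f : ℝ → ℂ} (ha : 0 < a) (hf : ContinuousOn f (Icc (-a) a)) :
    Tendsto f (𝓝[<] a) (𝓝 (f a)) := by
  rw [← nhdsWithin_Ioo_eq_nhdsLT (by linarith : -a < a)]
  exact (hf a ⟨by linarith, le_rfl⟩).mono Ioo_subset_Icc_self

lemma hasDerivAt_primitive_ae (ha : 0 < a) (hw : IntervalIntegrable w volume (-a) a) :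
    ∀ᵐ t, t ∈ Icc (-a) a → HasDerivAt (primitive a w) (w t) t := by
  filter_upwards [hw.ae_hasDerivAt_integral] with t h ht
  exact h (by rwa [uIcc_of_le (by linarith)]) (-a) left_mem_uIcc

end Primitive

section Source

variable {a : ℝ} {w : ℝ → ℂ} {s t : ℝ}

/-- The admissible right-hand sides `w` of `(p x')' = w`: square integrable with mean zero, so that
the primitive of `w` vanishes at both endpoints. -/
structure IsSource (a : ℝ) (w : ℝ → ℂ) : Prop where
  memLp : MemLp w 2 (intervalMeasure a)
  primitive_right : primitive a w a = 0

/-- The derivative `(1 / p(t)) ∫_{-a}^t w` of the solutions of `(p x')' = w` whose flux vanishes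
at both endpoints. -/
noncomputable def sourceDeriv (a : ℝ) (w : ℝ → ℂ) (t : ℝ) : ℂ := primitive a w t / weight a t

/-- The solution of `(p x')' = w` with vanishing flux at both endpoints and with `x(0) = 0`. -/
noncomputable def solve (a : ℝ) (w : ℝ → ℂ) (t : ℝ) : ℂ := ∫ s in (0 : ℝ)..t, sourceDeriv a w s

/-- A primitive of `1 / √(a + t) + 1 / √(a - t)`, which controls the modulus of continuity of
`solve a w` up to the endpoints. -/
noncomputable def gauge (a t : ℝ) : ℝ := 2 * √(a + t) - 2 * √(a - t)

@[fun_prop]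
lemma continuous_gauge (a : ℝ) : Continuous (gauge a) := by
  unfold gauge
  fun_prop

lemma hasDerivAt_gauge (ht : t ∈ Ioo (-a) a) :
    HasDerivAt (gauge a) (1 / √(a + t) + 1 / √(a - t)) t := by
  have hleft : a + t ≠ 0 := by linarith [ht.1]
  have hright : a - t ≠ 0 := by linarith [ht.2]
  refine (((((hasDerivAt_id t).const_add a).sqrt hleft).const_mul 2).sub
    ((((hasDerivAt_id t).const_sub a).sqrt hright).const_mul 2)).congr_deriv ?_
  simp only [id]
  ring

lemma intervalIntegrable_deriv_gauge (ha : 0 < a) :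
    IntervalIntegrable (fun t => 1 / √(a + t) + 1 / √(a - t)) volume (-a) a := by
  refine intervalIntegral.intervalIntegrable_deriv_of_nonneg
    (continuous_gauge a).continuousOn (fun t ht => hasDerivAt_gauge ?_) fun t _ => by positivity
  rwa [min_eq_left (by linarith), max_eq_right (by linarith)] at ht

lemma integral_deriv_gauge (hs : s ∈ Icc (-a) a) (ht : t ∈ Icc (-a) a) (hst : s ≤ t) (ha : 0 < a) :
    ∫ r in s..t, (1 / √(a + r) + 1 / √(a - r)) = gauge a t - gauge a s :=
  intervalIntegral.integral_eq_sub_of_hasDerivAt_of_le hst (continuous_gauge a).continuousOn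
    (fun _ hr => hasDerivAt_gauge ⟨hs.1.trans_lt hr.1, hr.2.trans_le ht.2⟩)
    (intervalIntegrable_of_mem_Icc (intervalIntegrable_deriv_gauge ha) hs ht)

lemma min_sqrt_div_weight_le (ht : t ∈ Ioo (-a) a) :
    min √(a + t) √(a - t) / weight a t ≤ a * (1 / √(a + t) + 1 / √(a - t)) := by
  have ha : 0 < a := by linarith [ht.1, ht.2]
  have hleft : 0 < √(a + t) := Real.sqrt_pos.2 (by linarith [ht.1])
  have hright : 0 < √(a - t) := Real.sqrt_pos.2 (by linarith [ht.2])
  have hsum : a = (√(a + t) ^ 2 + √(a - t) ^ 2) / 2 := by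
    rw [Real.sq_sqrt (by linarith [ht.1]), Real.sq_sqrt (by linarith [ht.2])]
    ring
  have hweight : weight a t = (√(a + t) * √(a - t) / a) ^ 2 := by
    rw [weight_eq ha.ne', div_pow, mul_pow, Real.sq_sqrt (by linarith [ht.1]),
      Real.sq_sqrt (by linarith [ht.2])]
  rw [div_le_iff₀ (weight_pos ht), hweight]
  generalize √(a + t) = p at *
  generalize √(a - t) = q at *
  have hrhs : a * (1 / p + 1 / q) * (p * q / a) ^ 2 = (p + q) * (p * q) / a := by
    field_simp
    ring
  rw [hrhs, le_div_iff₀ ha, hsum]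
  have := mul_pos hleft hright
  rcases le_total p q with h | h
  · rw [min_eq_left h]
    nlinarith [mul_le_mul_of_nonneg_left (pow_le_pow_left₀ hleft.le h 2) hleft.le]
  · rw [min_eq_right h]
    nlinarith [mul_le_mul_of_nonneg_left (pow_le_pow_left₀ hright.le h 2) hright.le]

lemma IsSource.intervalIntegrable (ha : 0 < a) (hw : IsSource a w) :
    IntervalIntegrable w volume (-a) a :=
  intervalIntegrable_of_memLp ha hw.memLp

lemma IsSource.norm_sourceDeriv_le (hw : IsSource a w) (ht : t ∈ Ioo (-a) a) :
    ‖sourceDeriv a w t‖ ≤ a * (eLpNorm w 2 (intervalMeasure a)).toReal *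
      (1 / √(a + t) + 1 / √(a - t)) := by
  have ha : 0 < a := by linarith [ht.1, ht.2]
  have ht' := Ioo_subset_Icc_self ht
  set N := (eLpNorm w 2 (intervalMeasure a)).toReal
  have hleft : ‖primitive a w t‖ ≤ √(a + t) * N := by
    simpa [primitive, add_comm] using
      norm_integral_le_sqrt_mul hw.memLp ⟨le_rfl, by linarith⟩ ht' ht'.1
  have hright : ‖primitive a w t‖ ≤ √(a - t) * N := by
    rw [eq_neg_of_add_eq_zero_left ((primitive_add_integral (hw.intervalIntegrable ha) ht').trans
      hw.primitive_right), norm_neg]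
    exact norm_integral_le_sqrt_mul hw.memLp ht' ⟨by linarith, le_rfl⟩ ht'.2
  calc ‖sourceDeriv a w t‖ = ‖primitive a w t‖ / weight a t := by
        rw [sourceDeriv, norm_div, Complex.norm_of_nonneg (weight_pos ht).le]
    _ ≤ min √(a + t) √(a - t) * N / weight a t := by
        have := (weight_pos ht).le
        gcongr
        rw [min_mul_of_nonneg _ _ ENNReal.toReal_nonneg]
        exact le_min hleft hright
    _ = N * (min √(a + t) √(a - t) / weight a t) := by ring
    _ ≤ N * (a * (1 / √(a + t) + 1 / √(a - t))) := by
        gcongr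
        exact min_sqrt_div_weight_le ht
    _ = _ := by ring

lemma continuousOn_sourceDeriv (ha : 0 < a) (hw : IntervalIntegrable w volume (-a) a) :
    ContinuousOn (sourceDeriv a w) (Ioo (-a) a) :=
  ((continuousOn_primitive ha hw).mono Ioo_subset_Icc_self).div
    (contDiff_weight a).continuous.continuousOn fun _ => weight_ne_zero

lemma IsSource.intervalIntegrable_sourceDeriv (ha : 0 < a) (hw : IsSource a w) :
    IntervalIntegrable (sourceDeriv a w) volume (-a) a := by
  have hmaj := (intervalIntegrable_deriv_gauge ha).const_mul
    (a * (eLpNorm w 2 (intervalMeasure a)).toReal)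
  rw [intervalIntegrable_iff_integrableOn_Ioo_of_le (by linarith)] at hmaj ⊢
  refine hmaj.mono' ((continuousOn_sourceDeriv ha (hw.intervalIntegrable ha)).aestronglyMeasurable
    measurableSet_Ioo) ?_
  filter_upwards [ae_restrict_mem measurableSet_Ioo] with t ht
  exact hw.norm_sourceDeriv_le ht

lemma IsSource.hasDerivAt_solve (hw : IsSource a w) (ht : t ∈ Ioo (-a) a) :
    HasDerivAt (solve a w) (sourceDeriv a w t) t := by
  have ha : 0 < a := by linarith [ht.1, ht.2]
  have hcont := continuousOn_sourceDeriv ha (hw.intervalIntegrable ha)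
  exact intervalIntegral.integral_hasDerivAt_right
    (intervalIntegrable_of_mem_Icc (hw.intervalIntegrable_sourceDeriv ha)
      ⟨by linarith, ha.le⟩ (Ioo_subset_Icc_self ht))
    (hcont.stronglyMeasurableAtFilter isOpen_Ioo t ht) (hcont.continuousAt (isOpen_Ioo.mem_nhds ht))

lemma IsSource.solve_sub (ha : 0 < a) (hw : IsSource a w) (hs : s ∈ Icc (-a) a)
    (ht : t ∈ Icc (-a) a) : solve a w t - solve a w s = ∫ r in s..t, sourceDeriv a w r :=
  have hintegrable {r : ℝ} (hr : r ∈ Icc (-a) a) :=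
    intervalIntegrable_of_mem_Icc (hw.intervalIntegrable_sourceDeriv ha)
      (⟨by linarith, ha.le⟩ : (0 : ℝ) ∈ Icc (-a) a) hr
  intervalIntegral.integral_interval_sub_left (hintegrable ht) (hintegrable hs)

lemma IsSource.dist_solve_le (ha : 0 < a) (hw : IsSource a w) (hs : s ∈ Icc (-a) a)
    (ht : t ∈ Icc (-a) a) :
    dist (solve a w s) (solve a w t) ≤
      a * (eLpNorm w 2 (intervalMeasure a)).toReal * dist (gauge a s) (gauge a t) := by
  wlog hst : s ≤ t generalizing s t
  · rw [dist_comm, dist_comm (gauge a s)]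
    exact this ht hs (le_of_not_ge hst)
  calc dist (solve a w s) (solve a w t) = ‖∫ r in s..t, sourceDeriv a w r‖ := by
        rw [dist_comm, dist_eq_norm, hw.solve_sub ha hs ht]
    _ ≤ ∫ r in s..t, a * (eLpNorm w 2 (intervalMeasure a)).toReal *
        (1 / √(a + r) + 1 / √(a - r)) := by
        refine intervalIntegral.norm_integral_le_of_norm_le hst ?_
          ((intervalIntegrable_of_mem_Icc (intervalIntegrable_deriv_gauge ha) hs ht).const_mul _)
        filter_upwards [Measure.ae_ne volume a] with r hr hmem
        exact hw.norm_sourceDeriv_le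
          ⟨hs.1.trans_lt hmem.1, (hmem.2.trans ht.2).lt_of_ne hr⟩
    _ = a * (eLpNorm w 2 (intervalMeasure a)).toReal * (gauge a t - gauge a s) := by
        rw [intervalIntegral.integral_const_mul, integral_deriv_gauge hs ht hst ha]
    _ ≤ _ := by
        rw [dist_comm, Real.dist_eq]
        gcongr
        exact le_abs_self _

lemma IsSource.absolutelyContinuousOnInterval_solve (ha : 0 < a) (hw : IsSource a w) :
    AbsolutelyContinuousOnInterval (solve a w) (-a) a :=
  absolutelyContinuousOnInterval_integral (hw.intervalIntegrable_sourceDeriv ha)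
    (by rw [uIcc_of_le (by linarith)]; exact ⟨by linarith, ha.le⟩)

lemma IsSource.continuousOn_solve (ha : 0 < a) (hw : IsSource a w) :
    ContinuousOn (solve a w) (Icc (-a) a) := by
  rw [← uIcc_of_le (by linarith : -a ≤ a)]
  exact (hw.absolutelyContinuousOnInterval_solve ha).continuousOn

end Source

section FluxSolution

variable {a : ℝ} {w x : ℝ → ℂ} {s t : ℝ}

lemma tendsto_flux_left_iff (ha : 0 < a) (c : ℂ) :
    Tendsto (flux a x) (𝓝[>] (-a)) (𝓝 (c * (2 / a : ℝ))) ↔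
      Tendsto (fun t : ℝ => ((t + a : ℝ) : ℂ) * deriv x t) (𝓝[>] (-a)) (𝓝 c) := by
  have hlim : (a - -a) / a ^ 2 = 2 / a := by
    field_simp
    ring
  have hfactor : Tendsto (fun t : ℝ => (((a - t) / a ^ 2 : ℝ) : ℂ)) (𝓝[>] (-a))
      (𝓝 (2 / a : ℝ)) := by
    rw [← hlim]
    exact (Continuous.tendsto (by fun_prop) (-a)).mono_left nhdsWithin_le_nhds
  refine Iff.trans (tendsto_congr fun t => ?_)
    (tendsto_mul_iff_of_ne_zero hfactor (Complex.ofReal_ne_zero.2 (by positivity)))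
  rw [flux_eq_weight_mul, weight_eq ha.ne']
  push_cast
  ring

lemma tendsto_flux_right_iff (ha : 0 < a) (c : ℂ) :
    Tendsto (flux a x) (𝓝[<] a) (𝓝 (c * (-(2 / a) : ℝ))) ↔
      Tendsto (fun t : ℝ => ((t - a : ℝ) : ℂ) * deriv x t) (𝓝[<] a) (𝓝 c) := by
  have hlim : -((a + a) / a ^ 2) = -(2 / a) := by
    field_simp
    ring
  have hfactor : Tendsto (fun t : ℝ => ((-((a + t) / a ^ 2) : ℝ) : ℂ)) (𝓝[<] a)
      (𝓝 (-(2 / a) : ℝ)) := by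
    rw [← hlim]
    exact (Continuous.tendsto (by fun_prop) a).mono_left nhdsWithin_le_nhds
  refine Iff.trans (tendsto_congr fun t => ?_) (tendsto_mul_iff_of_ne_zero hfactor
    (Complex.ofReal_ne_zero.2 (neg_ne_zero.2 (by positivity))))
  rw [flux_eq_weight_mul, weight_eq ha.ne']
  push_cast
  ring

lemma tendsto_flux_left_zero_iff (ha : 0 < a) :
    Tendsto (flux a x) (𝓝[>] (-a)) (𝓝 0) ↔
      Tendsto (fun t : ℝ => ((t + a : ℝ) : ℂ) * deriv x t) (𝓝[>] (-a)) (𝓝 0) := by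
  simpa only [zero_mul] using tendsto_flux_left_iff ha 0

lemma tendsto_flux_right_zero_iff (ha : 0 < a) :
    Tendsto (flux a x) (𝓝[<] a) (𝓝 0) ↔
      Tendsto (fun t : ℝ => ((t - a : ℝ) : ℂ) * deriv x t) (𝓝[<] a) (𝓝 0) := by
  simpa only [zero_mul] using tendsto_flux_right_iff ha 0

/-- `x` solves `(p x')' = w` on `(-a, a)`, with flux `p x'` vanishing at both endpoints. The
equation is integrated once, so that `w` matters only almost everywhere. -/
structure IsFluxSolution (a : ℝ) (w x : ℝ → ℂ) : Prop extends IsSource a w where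
  hasDerivAt : ∀ t ∈ Ioo (-a) a, HasDerivAt x (sourceDeriv a w t) t

lemma IsSource.isFluxSolution_solve (hw : IsSource a w) : IsFluxSolution a w (solve a w) :=
  ⟨hw, fun _ => hw.hasDerivAt_solve⟩

lemma memLp_of_continuousOn (hx : ContinuousOn x (Icc (-a) a)) :
    MemLp x 2 (intervalMeasure a) := by
  obtain ⟨C, hC⟩ := isCompact_Icc.exists_bound_of_continuousOn hx
  refine MemLp.of_bound ((hx.mono Ioo_subset_Icc_self).aestronglyMeasurable measurableSet_Ioo) C ?_
  filter_upwards [ae_restrict_mem measurableSet_Ioo] with t ht using hC t (Ioo_subset_Icc_self ht)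

lemma memLp_sq_mul (hx : MemLp x 2 (intervalMeasure a)) :
    MemLp (fun t => ((t ^ 2 : ℝ) : ℂ) * x t) 2 (intervalMeasure a) := by
  refine hx.of_le_mul (c := a ^ 2) ((by fun_prop : Measurable _).aestronglyMeasurable.mul hx.1) ?_
  filter_upwards [ae_restrict_mem measurableSet_Ioo] with t ht
  rw [norm_mul, Complex.norm_of_nonneg (sq_nonneg t)]
  exact mul_le_mul_of_nonneg_right (sq_le_sq' ht.1.le ht.2.le) (norm_nonneg _)

namespace IsFluxSolution

lemma flux_eq (h : IsFluxSolution a w x) (ht : t ∈ Ioo (-a) a) :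
    flux a x t = primitive a w t := by
  rw [flux_eq_weight_mul, (h.hasDerivAt t ht).deriv, sourceDeriv,
    mul_div_cancel₀ _ (weight_ne_zero ht)]

lemma eq_add_solve (h : IsFluxSolution a w x) (ht : t ∈ Ioo (-a) a) :
    x t = x 0 + solve a w t := by
  have ha : 0 < a := by linarith [ht.1, ht.2]
  have hderiv : ∀ s ∈ Ioo (-a) a, HasDerivAt (x - solve a w) 0 s := fun s hs => by
    simpa using (h.hasDerivAt s hs).sub (h.hasDerivAt_solve hs)
  have hconst := isOpen_Ioo.is_const_of_deriv_eq_zero isPreconnected_Ioo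
    (fun s hs => (hderiv s hs).differentiableAt.differentiableWithinAt)
    (fun s hs => (hderiv s hs).deriv) ht (⟨by linarith, ha⟩ : (0 : ℝ) ∈ Ioo (-a) a)
  simp only [Pi.sub_apply, solve, intervalIntegral.integral_same, sub_zero] at hconst
  rw [← hconst, solve, sub_add_cancel]

lemma continuousOn_add_solve (ha : 0 < a) (h : IsFluxSolution a w x) :
    ContinuousOn (fun t => x 0 + solve a w t) (Icc (-a) a) :=
  continuousOn_const.add (h.continuousOn_solve ha)

lemma ae_eq_add_solve (h : IsFluxSolution a w x) :
    (fun t => x 0 + solve a w t) =ᵐ[intervalMeasure a] x := by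
  filter_upwards [ae_restrict_mem measurableSet_Ioo] with t ht using (h.eq_add_solve ht).symm

lemma formalL_ae_eq (ha : 0 < a) (h : IsFluxSolution a w x) :
    formalL a x =ᵐ[intervalMeasure a] fun t => -w t + ((t ^ 2 : ℝ) : ℂ) * x t := by
  filter_upwards [ae_restrict_of_ae (hasDerivAt_primitive_ae ha (h.intervalIntegrable ha)),
    ae_restrict_mem measurableSet_Ioo] with t hprim ht
  have hflux : flux a x =ᶠ[𝓝 t] primitive a w := by
    filter_upwards [isOpen_Ioo.mem_nhds ht] with s hs using h.flux_eq hs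
  rw [formalL, hflux.deriv_eq, (hprim (Ioo_subset_Icc_self ht)).deriv]

lemma mem_classA (ha : 0 < a) (h : IsFluxSolution a w x) : x ∈ classA a := by
  refine ⟨fun t ht => (h.hasDerivAt t ht).differentiableAt, fun α β hα hαβ hβ => ?_⟩
  have hsub : uIcc α β ⊆ Ioo (-a) a := by
    rw [uIcc_of_le hαβ]
    exact Icc_subset_Ioo hα hβ
  have hprim : AbsolutelyContinuousOnInterval (primitive a w) α β := by
    refine (absolutelyContinuousOnInterval_primitive (h.intervalIntegrable ha)).mono ?_
    rw [uIcc_of_le (by linarith : -a ≤ a)]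
    exact hsub.trans Ioo_subset_Icc_self
  have hweight : ContDiffOn ℝ 1 (fun t => (weight a t : ℂ)⁻¹) (uIcc α β) :=
    (contDiff_weight a).contDiffOn.inv fun t ht => weight_ne_zero (hsub ht)
  refine absolutelyContinuousOnInterval_of_dist_le
    (hweight.absolutelyContinuousOnInterval.fun_smul hprim) fun s hs t ht => le_of_eq ?_
  have hderiv {r : ℝ} (hr : r ∈ uIcc α β) : deriv x r = (weight a r : ℂ)⁻¹ • primitive a w r := by
    rw [(h.hasDerivAt r (hsub hr)).deriv, sourceDeriv, div_eq_inv_mul, smul_eq_mul]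
  rw [hderiv hs, hderiv ht]

lemma memLp_solution (ha : 0 < a) (h : IsFluxSolution a w x) : MemLp x 2 (intervalMeasure a) :=
  (memLp_congr_ae h.ae_eq_add_solve).1 (memLp_of_continuousOn (h.continuousOn_add_solve ha))

lemma mem_domainI (ha : 0 < a) (h : IsFluxSolution a w x) : x ∈ domainI a := by
  have hcont := continuousOn_primitive ha (h.intervalIntegrable ha)
  refine ⟨⟨h.mem_classA ha, h.memLp_solution ha, (memLp_congr_ae (h.formalL_ae_eq ha)).2
    (h.memLp.neg.add (memLp_sq_mul (h.memLp_solution ha)))⟩, (tendsto_flux_left_zero_iff ha).1 ?_,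
    (tendsto_flux_right_zero_iff ha).1 ?_⟩
  · rw [← primitive_left a w]
    refine (tendsto_left_of_continuousOn ha hcont).congr' ?_
    filter_upwards [Ioo_mem_nhdsGT (by linarith : -a < a)] with t ht using (h.flux_eq ht).symm
  · rw [← h.primitive_right]
    refine (tendsto_right_of_continuousOn ha hcont).congr' ?_
    filter_upwards [Ioo_mem_nhdsLT (by linarith : -a < a)] with t ht using (h.flux_eq ht).symm

end IsFluxSolution

lemma absolutelyContinuousOnInterval_flux {α β : ℝ} (hx : x ∈ classA a) (hα : -a < α)
    (hαβ : α ≤ β) (hβ : β < a) : AbsolutelyContinuousOnInterval (flux a x) α β :=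
  (contDiff_weight a).contDiffOn.absolutelyContinuousOnInterval.fun_smul (hx.2 α β hα hαβ hβ)

lemma memLp_deriv_flux (hx : x ∈ domainMax a) :
    MemLp (deriv (flux a x)) 2 (intervalMeasure a) := by
  convert (memLp_sq_mul hx.2.1).sub hx.2.2 using 1
  ext t
  simp [formalL]

lemma flux_sub_flux (hx : x ∈ domainMax a) (hs : s ∈ Ioo (-a) a) (ht : t ∈ Ioo (-a) a)
    (hst : s ≤ t) : flux a x t - flux a x s = ∫ r in s..t, deriv (flux a x) r := by
  have ha : 0 < a := by linarith [hs.1, hs.2]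
  refine (integral_eq_sub_of_absolutelyContinuous
    (absolutelyContinuousOnInterval_flux hx.1 hs.1 hst ht.2)
    (intervalIntegrable_of_mem_Icc (intervalIntegrable_of_memLp ha (memLp_deriv_flux hx))
      (Ioo_subset_Icc_self hs) (Ioo_subset_Icc_self ht)) ?_).symm
  filter_upwards [(ae_restrict_iff' measurableSet_Ioo).1 (ae_differentiableAt_deriv hx.1)]
    with r hr hmem
  rw [uIcc_of_le hst] at hmem
  exact (differentiableAt_flux (hr ⟨hs.1.trans_le hmem.1, hmem.2.trans_lt ht.2⟩)).hasDerivAt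

lemma exists_flux_eq_add_primitive (ha : 0 < a) (hx : x ∈ domainMax a) :
    ∃ c, ∀ t ∈ Ioo (-a) a, flux a x t = c + primitive a (deriv (flux a x)) t := by
  have hintegrable := intervalIntegrable_of_memLp ha (memLp_deriv_flux hx)
  have hleft : -a ∈ Icc (-a) a := ⟨le_rfl, by linarith⟩
  have hincrement {s t : ℝ} (hs : s ∈ Ioo (-a) a) (ht : t ∈ Ioo (-a) a) (hst : s ≤ t) :
      flux a x t - flux a x s =
        primitive a (deriv (flux a x)) t - primitive a (deriv (flux a x)) s := by
    rw [flux_sub_flux hx hs ht hst]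
    exact (intervalIntegral.integral_interval_sub_left
      (intervalIntegrable_of_mem_Icc hintegrable hleft (Ioo_subset_Icc_self ht))
      (intervalIntegrable_of_mem_Icc hintegrable hleft (Ioo_subset_Icc_self hs))).symm
  have h0 : (0 : ℝ) ∈ Ioo (-a) a := ⟨by linarith, ha⟩
  refine ⟨flux a x 0 - primitive a (deriv (flux a x)) 0, fun t ht => ?_⟩
  rcases le_total 0 t with h | h
  · linear_combination hincrement h0 ht h
  · linear_combination -hincrement ht h0 h

lemma exists_tendsto_flux_left (ha : 0 < a) (hx : x ∈ domainMax a) :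
    ∃ c, Tendsto (flux a x) (𝓝[>] (-a)) (𝓝 c) := by
  obtain ⟨c, hc⟩ := exists_flux_eq_add_primitive ha hx
  refine ⟨_, ((tendsto_left_of_continuousOn ha (continuousOn_primitive ha
    (intervalIntegrable_of_memLp ha (memLp_deriv_flux hx)))).const_add c).congr' ?_⟩
  filter_upwards [Ioo_mem_nhdsGT (by linarith : -a < a)] with t ht using (hc t ht).symm

lemma exists_tendsto_flux_right (ha : 0 < a) (hx : x ∈ domainMax a) :
    ∃ c, Tendsto (flux a x) (𝓝[<] a) (𝓝 c) := by
  obtain ⟨c, hc⟩ := exists_flux_eq_add_primitive ha hx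
  refine ⟨_, ((tendsto_right_of_continuousOn ha (continuousOn_primitive ha
    (intervalIntegrable_of_memLp ha (memLp_deriv_flux hx)))).const_add c).congr' ?_⟩
  filter_upwards [Ioo_mem_nhdsLT (by linarith : -a < a)] with t ht using (hc t ht).symm

lemma flux_eq_primitive (hx : x ∈ domainI a) (ht : t ∈ Ioo (-a) a) :
    flux a x t = primitive a (deriv (flux a x)) t := by
  have ha : 0 < a := by linarith [ht.1, ht.2]
  obtain ⟨c, hc⟩ := exists_flux_eq_add_primitive ha hx.1
  have hlim := (tendsto_left_of_continuousOn ha (continuousOn_primitive ha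
    (intervalIntegrable_of_memLp ha (memLp_deriv_flux hx.1)))).const_add c
  rw [primitive_left, add_zero] at hlim
  have hc0 : c = 0 := by
    refine tendsto_nhds_unique_of_eventuallyEq hlim
      ((tendsto_flux_left_zero_iff ha).2 hx.2.1) ?_
    filter_upwards [Ioo_mem_nhdsGT (by linarith : -a < a)] with s hs using (hc s hs).symm
  rw [hc t ht, hc0, zero_add]

lemma isFluxSolution_of_mem_domainI (ha : 0 < a) (hx : x ∈ domainI a) :
    IsFluxSolution a (deriv (flux a x)) x := by
  have hmemLp := memLp_deriv_flux hx.1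
  refine ⟨⟨hmemLp, ?_⟩, fun t ht => ?_⟩
  · refine tendsto_nhds_unique_of_eventuallyEq (tendsto_right_of_continuousOn ha
      (continuousOn_primitive ha (intervalIntegrable_of_memLp ha hmemLp)))
      ((tendsto_flux_right_zero_iff ha).2 hx.2.2) ?_
    filter_upwards [Ioo_mem_nhdsLT (by linarith : -a < a)] with t ht
    exact (flux_eq_primitive hx ht).symm
  · rw [sourceDeriv, ← flux_eq_primitive hx ht, ← deriv_eq_flux_div_weight x ht]
    exact (hx.1.1.1 t ht).hasDerivAt

end FluxSolution

section QuadraticForm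

variable {a : ℝ} {w x : ℝ → ℂ}

open scoped ComplexConjugate

lemma IsSource.intervalIntegrable_primitive_mul_conj (ha : 0 < a) (hw : IsSource a w) :
    IntervalIntegrable (fun t => primitive a w t * conj (sourceDeriv a w t)) volume (-a) a := by
  have hconj {μ : Measure ℝ} (hμ : Integrable (sourceDeriv a w) μ) :
      Integrable (fun t => conj (sourceDeriv a w t)) μ :=
    Complex.conjLIE.toContinuousLinearEquiv.integrable_comp_iff.2 hμ
  have hderiv := hw.intervalIntegrable_sourceDeriv ha
  refine IntervalIntegrable.continuousOn_mul ⟨hconj hderiv.1, hconj hderiv.2⟩ ?_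
  rw [uIcc_of_le (by linarith : -a ≤ a)]
  exact continuousOn_primitive ha (hw.intervalIntegrable ha)

lemma IsFluxSolution.integral_mul_conj (ha : 0 < a) (h : IsFluxSolution a w x) :
    ∫ t, w t * conj (x t) ∂(intervalMeasure a) =
      -((∫ t, ‖primitive a w t‖ ^ 2 / weight a t ∂(intervalMeasure a) : ℝ) : ℂ) := by
  have hle : -a ≤ a := by linarith
  have hIcc : uIcc (-a) a = Icc (-a) a := uIcc_of_le hle
  have hw := h.intervalIntegrable ha
  set z : ℝ → ℂ := fun t => conj (x 0 + solve a w t)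
  have hz : AbsolutelyContinuousOnInterval z (-a) a :=
    absolutelyContinuousOnInterval_of_dist_le (h.absolutelyContinuousOnInterval_solve ha)
      fun s _ t _ => by rw [Complex.dist_conj_conj, dist_add_left]
  have hwz : IntervalIntegrable (fun t => w t * z t) volume (-a) a :=
    hw.mul_continuousOn hz.continuousOn
  have hUz := h.intervalIntegrable_primitive_mul_conj ha
  have hparts : ∫ t in (-a)..a, (w t * z t + primitive a w t * conj (sourceDeriv a w t)) = 0 := by
    rw [integral_eq_sub_of_absolutelyContinuous
      ((absolutelyContinuousOnInterval_primitive hw).fun_smul hz) (hwz.add hUz)]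
    · simp [h.primitive_right, primitive_left]
    filter_upwards [hasDerivAt_primitive_ae ha hw, Measure.ae_ne volume (-a),
      Measure.ae_ne volume a] with t hprim hleft hright ht
    rw [hIcc] at ht
    exact (hprim ht).mul (((h.hasDerivAt_solve
      ⟨ht.1.lt_of_ne hleft.symm, ht.2.lt_of_ne hright⟩).const_add (x 0)).star)
  rw [intervalIntegral.integral_add hwz hUz, intervalIntegral.integral_of_le hle,
    intervalIntegral.integral_of_le hle, integral_Ioc_eq_integral_Ioo,
    integral_Ioc_eq_integral_Ioo] at hparts
  rw [← integral_complex_ofReal, eq_neg_iff_add_eq_zero, ← hparts]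
  congr 1
  · exact setIntegral_congr_fun measurableSet_Ioo fun t ht => by
      simp only [z, ← h.eq_add_solve ht]
  · refine integral_congr_ae (ae_of_all _ fun t => ?_)
    simp only [sourceDeriv, map_div₀, Complex.conj_ofReal, mul_div_assoc', Complex.mul_conj,
      Complex.normSq_eq_norm_sq, Complex.ofReal_div]

lemma mem_graph_operatorI_iff (ha : 0 < a) {f g : HilbertL2 a} :
    (f, g) ∈ (operatorI a ha).graph ↔ ∃ w x, IsFluxSolution a w x ∧ f =ᵐ[intervalMeasure a] x ∧
      g =ᵐ[intervalMeasure a] fun t => -w t + ((t ^ 2 : ℝ) : ℂ) * x t := by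
  rw [operatorI_graph]
  constructor
  · rintro ⟨x, hx, hf, hg⟩
    have hsol := isFluxSolution_of_mem_domainI ha hx
    exact ⟨_, x, hsol, hf, hg.trans (hsol.formalL_ae_eq ha)⟩
  · rintro ⟨w, x, hsol, hf, hg⟩
    exact ⟨x, hsol.mem_domainI ha, hf, hg.trans (hsol.formalL_ae_eq ha).symm⟩

lemma integrable_sq_mul_norm_sq (hx : MemLp x 2 (intervalMeasure a)) :
    Integrable (fun t => t ^ 2 * ‖x t‖ ^ 2) (intervalMeasure a) := by
  refine ((memLp_sq_mul hx).norm.integrable_mul hx.norm).congr (ae_of_all _ fun t => ?_)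
  simp only [Pi.mul_apply, norm_mul, Complex.norm_of_nonneg (sq_nonneg t)]
  ring

lemma integral_sq_mul_norm_sq_pos (hx : MemLp x 2 (intervalMeasure a))
    (h0 : ¬ x =ᵐ[intervalMeasure a] 0) : 0 < ∫ t, t ^ 2 * ‖x t‖ ^ 2 ∂(intervalMeasure a) := by
  refine (integral_nonneg fun t => by positivity).lt_of_ne fun hzero => h0 ?_
  rw [eq_comm, integral_eq_zero_iff_of_nonneg (fun t => by positivity)
    (integrable_sq_mul_norm_sq hx)] at hzero
  filter_upwards [hzero, ae_restrict_of_ae (Measure.ae_ne volume 0)] with t ht hne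
  simpa [hne] using ht

lemma hasPositiveForm_operatorI (ha : 0 < a) : HasPositiveForm (operatorI a ha) := by
  intro f hne
  obtain ⟨w, x, h, hf, hg⟩ := (mem_graph_operatorI_iff ha).1 (LinearPMap.mem_graph _ f)
  have hx := h.memLp_solution ha
  have hpos := integral_sq_mul_norm_sq_pos hx fun h0 =>
    hne (Lp.ext ((hf.trans h0).trans (Lp.coeFn_zero _ _ _).symm))
  have henergy : 0 ≤ ∫ t, ‖primitive a w t‖ ^ 2 / weight a t ∂(intervalMeasure a) :=
    setIntegral_nonneg measurableSet_Ioo fun t ht => by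
      have := weight_pos ht
      positivity
  refine ⟨_, add_pos_of_nonneg_of_pos henergy hpos, ?_⟩
  rw [Complex.ofReal_add, ← neg_eq_iff_eq_neg.2 (h.integral_mul_conj ha),
    ← integral_complex_ofReal, ← integral_neg, L2.inner_def]
  refine Eq.trans (integral_congr_ae ?_)
    (integral_add (h.memLp.integrable_mul hx.star).neg (integrable_sq_mul_norm_sq hx).ofReal)
  filter_upwards [hf, hg] with t hft hgt
  rw [hft, hgt, RCLike.inner_apply, add_mul, neg_mul, mul_assoc, Complex.mul_conj,
    Complex.normSq_eq_norm_sq, ← Complex.ofReal_mul]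

end QuadraticForm

section Parametrix

lemma isCompactOperator_of_dist_le {E F X Y : Type*} [NormedAddCommGroup E] [NormedSpace ℂ E]
    [NormedAddCommGroup F] [NormedSpace ℂ F] [ProperSpace F] [TopologicalSpace X] [CompactSpace X]
    [PseudoMetricSpace Y] {T : E →ₗ[ℂ] BoundedContinuousFunction X F} {φ : X → Y} {C K : ℝ}
    (hφ : Continuous φ) (hbound : ∀ f, ‖f‖ ≤ 1 → ∀ x, ‖T f x‖ ≤ C)
    (hdist : ∀ f, ‖f‖ ≤ 1 → ∀ x y, dist (T f x) (T f y) ≤ K * dist (φ x) (φ y)) :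
    IsCompactOperator T := by
  rw [isCompactOperator_iff_isCompact_closure_image_closedBall T one_pos]
  refine BoundedContinuousFunction.arzela_ascoli _ (isCompact_closedBall (0 : F) C) _ ?_ fun x =>
    Metric.equicontinuousAt_of_continuity_modulus (fun y => K * dist (φ x) (φ y)) ?_ _
      (Eventually.of_forall fun y => ?_)
  · rintro _ x ⟨f, hf, rfl⟩
    exact mem_closedBall_zero_iff.2 (hbound f (mem_closedBall_zero_iff.1 hf) x)
  · exact Continuous.tendsto' (by fun_prop) _ _ (by simp)
  · rintro ⟨_, f, hf, rfl⟩
    exact hdist f (mem_closedBall_zero_iff.1 hf) x y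

variable {a : ℝ} {w v x : ℝ → ℂ} {t : ℝ}

lemma solve_congr_ae (h : w =ᵐ[intervalMeasure a] v) (ht : t ∈ Icc (-a) a) :
    solve a w t = solve a v t := by
  have h0 : (0 : ℝ) ∈ Icc (-a) a := ⟨by linarith [ht.1, ht.2], by linarith [ht.1, ht.2]⟩
  refine intervalIntegral.integral_congr fun s hs => ?_
  simp only [sourceDeriv, primitive_congr_ae h (uIcc_subset_Icc h0 ht hs)]

lemma solve_add (ha : 0 < a) (hw : IsSource a w) (hv : IsSource a v) (ht : t ∈ Icc (-a) a) :
    solve a (w + v) t = solve a w t + solve a v t := by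
  have h0 : (0 : ℝ) ∈ Icc (-a) a := ⟨by linarith, ha.le⟩
  rw [solve, solve, solve, ← intervalIntegral.integral_add
    (intervalIntegrable_of_mem_Icc (hw.intervalIntegrable_sourceDeriv ha) h0 ht)
    (intervalIntegrable_of_mem_Icc (hv.intervalIntegrable_sourceDeriv ha) h0 ht)]
  refine intervalIntegral.integral_congr fun s hs => ?_
  simp only [sourceDeriv, primitive_add (hw.intervalIntegrable ha) (hv.intervalIntegrable ha)
    (uIcc_subset_Icc h0 ht hs), add_div]

lemma solve_smul (a : ℝ) (c : ℂ) (w : ℝ → ℂ) (t : ℝ) : solve a (c • w) t = c * solve a w t := by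
  simp only [solve, sourceDeriv, primitive_smul, mul_div_assoc,
    intervalIntegral.integral_const_mul]

lemma IsFluxSolution.const_sub (h : IsFluxSolution a w x) (c : ℂ) :
    IsFluxSolution a (-w) fun t => c - x t := by
  have hneg (s : ℝ) : primitive a (-w) s = -primitive a w s := intervalIntegral.integral_neg
  refine ⟨⟨h.memLp.neg, by rw [hneg, h.primitive_right, neg_zero]⟩, fun s hs => ?_⟩
  rw [sourceDeriv, hneg, neg_div]
  exact (h.hasDerivAt s hs).const_sub c

/-- The constant functions in `L²((-a, a))`; their orthogonal complement consists of the functions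
of mean zero. -/
noncomputable abbrev constants (a : ℝ) : Submodule ℂ (HilbertL2 a) :=
  LinearMap.range (Lp.constₗ 2 (intervalMeasure a) ℂ : ℂ →ₗ[ℂ] HilbertL2 a)

lemma exists_ae_eq_const_of_mem_constants {f : HilbertL2 a} (hf : f ∈ constants a) :
    ∃ c : ℂ, f =ᵐ[intervalMeasure a] fun _ => c := by
  obtain ⟨c, rfl⟩ := hf
  exact ⟨c, Lp.coeFn_const 2 _ c⟩

lemma isSource_of_mem_orthogonal_constants (ha : 0 < a) {g : HilbertL2 a}
    (hg : g ∈ (constants a)ᗮ) : IsSource a g := by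
  refine ⟨Lp.memLp g, ?_⟩
  rw [primitive, intervalIntegral.integral_of_le (by linarith), integral_Ioc_eq_integral_Ioo,
    ← (Submodule.mem_orthogonal _ _).1 hg _ ⟨1, rfl⟩, L2.inner_def]
  refine integral_congr_ae ?_
  filter_upwards [Lp.coeFn_const 2 (intervalMeasure a) (1 : ℂ)] with t ht
  rw [show Lp.constₗ 2 (intervalMeasure a) ℂ (1 : ℂ) t = 1 from ht]
  simp

/-- `solve a` as a linear map from the mean zero functions to the continuous functions on the
closed interval. -/
noncomputable def solveLinear (ha : 0 < a) :
    (constants a)ᗮ →ₗ[ℂ] BoundedContinuousFunction (Icc (-a) a) ℂ where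
  toFun g := BoundedContinuousFunction.mkOfCompact ⟨(Icc (-a) a).domRestrict (solve a g),
    ((isSource_of_mem_orthogonal_constants ha g.2).continuousOn_solve ha).domRestrict⟩
  map_add' f g := by
    ext t
    exact (solve_congr_ae (Lp.coeFn_add _ _) t.2).trans
      (solve_add ha (isSource_of_mem_orthogonal_constants ha f.2)
        (isSource_of_mem_orthogonal_constants ha g.2) t.2)
  map_smul' c f := by
    ext t
    exact (solve_congr_ae (Lp.coeFn_smul _ _) t.2).trans (solve_smul a c f t)

lemma solveLinear_apply (ha : 0 < a) (g : (constants a)ᗮ) (t : Icc (-a) a) :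
    solveLinear ha g t = solve a g t := rfl

lemma isCompactOperator_solveLinear (ha : 0 < a) : IsCompactOperator (solveLinear ha) := by
  have hdist (g : (constants a)ᗮ) (hg : ‖g‖ ≤ 1) (s t : Icc (-a) a) :
      dist (solveLinear ha g s) (solveLinear ha g t) ≤ a * dist (gauge a s) (gauge a t) := by
    refine ((isSource_of_mem_orthogonal_constants ha g.2).dist_solve_le ha s.2 t.2).trans ?_
    rw [← Lp.norm_def]
    gcongr
    exact mul_le_of_le_one_right ha.le hg
  obtain ⟨C, hC⟩ := isCompact_univ.exists_bound_of_continuousOn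
    (f := fun t : Icc (-a) a => gauge a t) (by fun_prop)
  have h0 : (0 : ℝ) ∈ Icc (-a) a := ⟨by linarith, ha.le⟩
  refine isCompactOperator_of_dist_le (C := a * C) (by fun_prop) (fun g hg t => ?_) hdist
  have := hdist g hg t ⟨0, h0⟩
  rw [solveLinear_apply, solveLinear_apply, solve, solve, intervalIntegral.integral_same,
    dist_zero_right, gauge, gauge, add_zero, sub_zero, sub_self, dist_zero_right] at this
  exact this.trans (by gcongr; exact hC t trivial)

/-- The inclusion of the continuous functions on `[-a, a]` into `L²((-a, a))`. -/
noncomputable def toHilbertL2 (ha : 0 < a) :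
    BoundedContinuousFunction (Icc (-a) a) ℂ →L[ℂ] HilbertL2 a :=
  BoundedContinuousFunction.toLp 2 (intervalMeasure a) ℂ ∘L
    BoundedContinuousFunction.compContinuousCLM ℂ ℂ
      ⟨projIcc (-a) a (by linarith), continuous_projIcc⟩

/-- `solve a` as a bounded operator from the mean zero functions to `L²((-a, a))`. -/
noncomputable def solveL (ha : 0 < a) : (constants a)ᗮ →L[ℂ] HilbertL2 a :=
  toHilbertL2 ha ∘L ContinuousLinearMap.mkOfIsCompactOperator (isCompactOperator_solveLinear ha)

lemma isCompactOperator_solveL (ha : 0 < a) : IsCompactOperator (solveL ha) :=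
  (isCompactOperator_solveLinear ha).clm_comp (toHilbertL2 ha)

lemma coeFn_solveL (ha : 0 < a) (g : (constants a)ᗮ) :
    solveL ha g =ᵐ[intervalMeasure a] solve a g := by
  filter_upwards [BoundedContinuousFunction.coeFn_toLp 2 (intervalMeasure a) ℂ
    (BoundedContinuousFunction.compContinuousCLM ℂ ℂ
      ⟨projIcc (-a) a (by linarith), continuous_projIcc⟩ (solveLinear ha g)),
    ae_restrict_mem measurableSet_Ioo] with t hcoe ht
  refine hcoe.trans ?_
  rw [BoundedContinuousFunction.compContinuousCLM_apply,
    BoundedContinuousFunction.compContinuous_apply, ContinuousMap.coe_mk,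
    projIcc_of_mem _ (Ioo_subset_Icc_self ht), solveLinear_apply]

lemma memLp_top_sq (a : ℝ) : MemLp (fun t : ℝ => ((t ^ 2 : ℝ) : ℂ)) ⊤ (intervalMeasure a) := by
  refine memLp_top_of_bound (by fun_prop : Continuous _).aestronglyMeasurable (a ^ 2) ?_
  filter_upwards [ae_restrict_mem measurableSet_Ioo] with t ht
  rw [Complex.norm_of_nonneg (sq_nonneg t)]
  exact sq_le_sq' ht.1.le ht.2.le

/-- Multiplication by `t²` on `L²((-a, a))`. -/
noncomputable def mulSq (a : ℝ) : HilbertL2 a →L[ℂ] HilbertL2 a :=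
  (ContinuousLinearMap.mul ℂ ℂ).holderL (intervalMeasure a) ⊤ 2 2 (memLp_top_sq a).toLp

lemma coeFn_mulSq (a : ℝ) (f : HilbertL2 a) :
    mulSq a f =ᵐ[intervalMeasure a] fun t => ((t ^ 2 : ℝ) : ℂ) * f t := by
  filter_upwards [(ContinuousLinearMap.mul ℂ ℂ).coeFn_holder (r := 2) (memLp_top_sq a).toLp f,
    (memLp_top_sq a).coeFn_toLp] with t hmul hsq
  exact hmul.trans (congrArg (· * f t) hsq)

/-- The inverse of `x ↦ -(p x')'` on the mean zero functions, extended by the identity on the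
constants. It inverts `operatorI a ha` up to a compact error. -/
noncomputable def parametrix (ha : 0 < a) : HilbertL2 a →L[ℂ] HilbertL2 a :=
  (constants a).starProjection - solveL ha ∘L (constants a)ᗮ.orthogonalProjectionOnto

lemma isCompactOperator_starProjection_constants (a : ℝ) :
    IsCompactOperator (constants a).starProjection :=
  (isCompactOperator_of_locallyCompactSpace_dom (constants a).orthogonalProjectionOnto).clm_comp
    (constants a).subtypeL

lemma isCompactOperator_parametrix (ha : 0 < a) : IsCompactOperator (parametrix ha) :=
  (isCompactOperator_starProjection_constants a).sub ((isCompactOperator_solveL ha).comp_clm _)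

lemma parametrix_mem_graph (ha : 0 < a) (g : HilbertL2 a) :
    (parametrix ha g, g + (mulSq a (parametrix ha g) - (constants a).starProjection g)) ∈
      (operatorI a ha).graph := by
  set h := (constants a)ᗮ.orthogonalProjectionOnto g
  obtain ⟨c, hc⟩ := exists_ae_eq_const_of_mem_constants
    ((constants a).starProjection_apply_mem g)
  have hparametrix : parametrix ha g =ᵐ[intervalMeasure a] fun t => c - solve a h t := by
    filter_upwards [Lp.coeFn_sub ((constants a).starProjection g) (solveL ha h), hc,
      coeFn_solveL ha h] with t hsub hc hsolve
    exact hsub.trans (congrArg₂ (· - ·) hc hsolve)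
  have hsplit : g + (mulSq a (parametrix ha g) - (constants a).starProjection g) =
      h + mulSq a (parametrix ha g) := by
    rw [add_sub_assoc', sub_eq_iff_eq_add, add_right_comm, add_comm (h : HilbertL2 a)]
    exact congrArg (· + _) (Submodule.starProjection_add_starProjection_orthogonal g).symm
  refine (mem_graph_operatorI_iff ha).2 ⟨_, _,
    (isSource_of_mem_orthogonal_constants ha h.2).isFluxSolution_solve.const_sub c,
    hparametrix, ?_⟩
  rw [hsplit]
  filter_upwards [Lp.coeFn_add (h : HilbertL2 a) (mulSq a (parametrix ha g)),
    coeFn_mulSq a (parametrix ha g), hparametrix] with t hadd hmul hpar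
  rw [hadd, Pi.add_apply, hmul, hpar, Pi.neg_apply, neg_neg]

lemma apply_parametrix (ha : 0 < a) (g : HilbertL2 a) :
    ∃ h : parametrix ha g ∈ (operatorI a ha).domain, operatorI a ha ⟨parametrix ha g, h⟩ =
      g + (mulSq a (parametrix ha g) - (constants a).starProjection g) :=
  have hgraph := parametrix_mem_graph ha g
  have hdomain := LinearPMap.mem_domain_of_mem_graph hgraph
  ⟨hdomain, ((LinearPMap.image_iff hdomain).2 hgraph).symm⟩

lemma eq_zero_of_parametrix_eq_zero (ha : 0 < a) {g : HilbertL2 a} (hg : parametrix ha g = 0) :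
    g = 0 := by
  have hgraph := parametrix_mem_graph ha g
  rw [hg, map_zero, zero_sub, ← sub_eq_add_neg] at hgraph
  have hconst : g = (constants a).starProjection g :=
    sub_eq_zero.1 ((operatorI a ha).graph_fst_eq_zero_snd hgraph rfl)
  have horth : (constants a)ᗮ.orthogonalProjectionOnto g = 0 := by
    rw [hconst]
    exact Submodule.orthogonalProjectionOnto_orthogonal_apply_eq_zero
      ((constants a).starProjection_apply_mem g)
  rw [parametrix, sub_apply, ContinuousLinearMap.comp_apply, horth, map_zero,
    sub_zero, ← hconst] at hg
  exact hg

lemma exists_compact_isInverse_operatorI (ha : 0 < a) :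
    ∃ R : HilbertL2 a →L[ℂ] HilbertL2 a, IsCompactOperator R ∧ IsInverse (operatorI a ha) R :=
  exists_compact_isInverse (hasPositiveForm_operatorI ha).eq_zero_of_apply_eq_zero
    (isCompactOperator_parametrix ha)
    (C := mulSq a ∘L parametrix ha - (constants a).starProjection)
    (((isCompactOperator_parametrix ha).clm_comp (mulSq a)).sub
      (isCompactOperator_starProjection_constants a))
    (fun _ => eq_zero_of_parametrix_eq_zero ha) (apply_parametrix ha)

end Parametrix

section LogarithmicSingularity

variable {F : Type*} [NormedAddCommGroup F] [NormedSpace ℝ F]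

lemma eq_zero_of_tendsto_of_tendsto_hasDerivAt {f f' : ℝ → F} {d ℓ : F}
    (hderiv : ∀ᶠ s in atTop, HasDerivAt f (f' s) s) (hd : Tendsto f' atTop (𝓝 d))
    (hf : Tendsto f atTop (𝓝 ℓ)) : d = 0 := by
  refine norm_le_zero_iff.1 (le_of_forall_pos_le_add fun ε hε => ?_)
  obtain ⟨S, hS⟩ := eventually_atTop.1
    (hderiv.and ((tendsto_iff_norm_sub_tendsto_zero.1 hd).eventually_le_const hε))
  have hincrement : ∀ s ≥ S, ‖f (s + 1) - f s - d‖ ≤ ε := fun s hs => by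
    have hmvt := (convex_Icc s (s + 1)).norm_image_sub_le_of_norm_hasDerivWithin_le
      (f := fun r => f r - r • d) (C := ε)
      (fun r hr => ((hS r (hs.trans hr.1)).1.sub
        ((hasDerivAt_id r).smul_const d)).hasDerivWithinAt)
      (fun r hr => by simpa using (hS r (hs.trans hr.1)).2)
      (left_mem_Icc.2 (by linarith)) (right_mem_Icc.2 (by linarith))
    rw [add_sub_cancel_left, norm_one, mul_one] at hmvt
    refine le_of_eq_of_le (congrArg norm ?_) hmvt
    module
  have hlim : Tendsto (fun s => f (s + 1) - f s - d) atTop (𝓝 (ℓ - ℓ - d)) :=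
    ((hf.comp (tendsto_atTop_add_const_right _ 1 tendsto_id)).sub hf).sub_const d
  rw [sub_self, zero_sub] at hlim
  rw [zero_add, ← norm_neg]
  exact le_of_tendsto hlim.norm (eventually_atTop.2 ⟨S, hincrement⟩)

-- In the coordinate `s` with `t = b + σ exp (-s)` the operator `(t - b) d/dt` becomes `-d/ds`.
lemma eq_zero_of_tendsto_sub_smul_deriv {x x' : ℝ → F} {b σ : ℝ} {d ℓ : F} {l : Filter ℝ}
    (hl : Tendsto (fun s => b + σ * Real.exp (-s)) atTop l)
    (hderiv : ∀ᶠ t in l, HasDerivAt x (x' t) t)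
    (hd : Tendsto (fun t => (t - b) • x' t) l (𝓝 d)) (hx : Tendsto x l (𝓝 ℓ)) : d = 0 := by
  refine neg_eq_zero.1 (eq_zero_of_tendsto_of_tendsto_hasDerivAt ?_ (hd.comp hl).neg (hx.comp hl))
  filter_upwards [hl.eventually hderiv] with s hs
  have hexp : HasDerivAt (fun s => b + σ * Real.exp (-s)) (-(σ * Real.exp (-s))) s := by
    simpa using (((hasDerivAt_neg s).exp).const_mul σ).const_add b
  refine (hs.scomp s hexp).congr_deriv ?_
  rw [neg_smul, Function.comp_apply, add_sub_cancel_left]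

lemma tendsto_add_mul_exp_neg (b σ : ℝ) :
    Tendsto (fun s => b + σ * Real.exp (-s)) atTop (𝓝 b) := by
  simpa using (Real.tendsto_exp_neg_atTop_nhds_zero.const_mul σ).const_add b

lemma eq_zero_of_tendsto_sub_smul_deriv_right {x x' : ℝ → F} {b : ℝ} {d ℓ : F}
    (hderiv : ∀ᶠ t in 𝓝[>] b, HasDerivAt x (x' t) t)
    (hd : Tendsto (fun t => (t - b) • x' t) (𝓝[>] b) (𝓝 d)) (hx : Tendsto x (𝓝[>] b) (𝓝 ℓ)) :
    d = 0 :=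
  eq_zero_of_tendsto_sub_smul_deriv (σ := 1) (tendsto_nhdsWithin_iff.2
    ⟨tendsto_add_mul_exp_neg b 1, .of_forall fun s => by simp [Real.exp_pos]⟩) hderiv hd hx

lemma eq_zero_of_tendsto_sub_smul_deriv_left {x x' : ℝ → F} {b : ℝ} {d ℓ : F}
    (hderiv : ∀ᶠ t in 𝓝[<] b, HasDerivAt x (x' t) t)
    (hd : Tendsto (fun t => (t - b) • x' t) (𝓝[<] b) (𝓝 d)) (hx : Tendsto x (𝓝[<] b) (𝓝 ℓ)) :
    d = 0 :=
  eq_zero_of_tendsto_sub_smul_deriv (σ := -1) (tendsto_nhdsWithin_iff.2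
    ⟨tendsto_add_mul_exp_neg b (-1), .of_forall fun s => by simp [Real.exp_pos]⟩) hderiv hd hx

end LogarithmicSingularity

section FiniteLimits

variable {a : ℝ} {x : ℝ → ℂ}

lemma tendsto_flux_left_of_tendsto (ha : 0 < a) (hx : x ∈ domainMax a) {ℓ : ℂ}
    (hlim : Tendsto x (𝓝[>] (-a)) (𝓝 ℓ)) : Tendsto (flux a x) (𝓝[>] (-a)) (𝓝 0) := by
  obtain ⟨c, hc⟩ := exists_tendsto_flux_left ha hx
  have hne : ((2 / a : ℝ) : ℂ) ≠ 0 := Complex.ofReal_ne_zero.2 (by positivity)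
  rw [← div_mul_cancel₀ c hne] at hc
  have hzero : c / (2 / a : ℝ) = 0 := by
    refine eq_zero_of_tendsto_sub_smul_deriv_right (x' := deriv x) ?_ ?_ hlim
    · filter_upwards [Ioo_mem_nhdsGT (by linarith : -a < a)] with t ht
        using (hx.1.1 t ht).hasDerivAt
    · simpa only [Complex.real_smul, sub_neg_eq_add] using (tendsto_flux_left_iff ha _).1 hc
  rwa [hzero, zero_mul] at hc

lemma tendsto_flux_right_of_tendsto (ha : 0 < a) (hx : x ∈ domainMax a) {ℓ : ℂ}
    (hlim : Tendsto x (𝓝[<] a) (𝓝 ℓ)) : Tendsto (flux a x) (𝓝[<] a) (𝓝 0) := by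
  obtain ⟨c, hc⟩ := exists_tendsto_flux_right ha hx
  have hne : ((-(2 / a) : ℝ) : ℂ) ≠ 0 :=
    Complex.ofReal_ne_zero.2 (neg_ne_zero.2 (by positivity))
  rw [← div_mul_cancel₀ c hne] at hc
  have hzero : c / (-(2 / a) : ℝ) = 0 := by
    refine eq_zero_of_tendsto_sub_smul_deriv_left (x' := deriv x) ?_ ?_ hlim
    · filter_upwards [Ioo_mem_nhdsLT (by linarith : -a < a)] with t ht
        using (hx.1.1 t ht).hasDerivAt
    · simpa only [Complex.real_smul] using (tendsto_flux_right_iff ha _).1 hc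
  rwa [hzero, zero_mul] at hc

lemma mem_domainI_of_tendsto (ha : 0 < a) (hx : x ∈ domainMax a) {ℓ ℓ' : ℂ}
    (hleft : Tendsto x (𝓝[>] (-a)) (𝓝 ℓ)) (hright : Tendsto x (𝓝[<] a) (𝓝 ℓ')) :
    x ∈ domainI a :=
  ⟨hx, (tendsto_flux_left_zero_iff ha).1 (tendsto_flux_left_of_tendsto ha hx hleft),
    (tendsto_flux_right_zero_iff ha).1 (tendsto_flux_right_of_tendsto ha hx hright)⟩

lemma memLp_of_tendsto (hx : ContinuousOn x (Ioo (-a) a)) {ℓ ℓ' : ℂ}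
    (hleft : Tendsto x (𝓝[>] (-a)) (𝓝 ℓ)) (hright : Tendsto x (𝓝[<] a) (𝓝 ℓ')) :
    MemLp x 2 (intervalMeasure a) := by
  refine (memLp_congr_ae ?_).1
    (memLp_of_continuousOn (continuousOn_Icc_extendFrom_Ioo hx hleft hright))
  filter_upwards [ae_restrict_mem measurableSet_Ioo] with t ht
  exact extendFrom_eq (subset_closure ht) (hx t ht)

end FiniteLimits

section Eigenfunction

variable {a : ℝ} {z : ℂ} {w v x : ℝ → ℂ} {t : ℝ}

lemma IsFluxSolution.congr_ae (ha : 0 < a) (h : IsFluxSolution a w x)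
    (hwv : w =ᵐ[intervalMeasure a] v) : IsFluxSolution a v x := by
  have hright := primitive_congr_ae hwv (t := a) ⟨by linarith, le_rfl⟩
  refine ⟨⟨(memLp_congr_ae hwv).1 h.memLp, hright ▸ h.primitive_right⟩, fun t ht => ?_⟩
  rw [sourceDeriv, ← primitive_congr_ae hwv (Ioo_subset_Icc_self ht)]
  exact h.hasDerivAt t ht

lemma continuousOn_sq_sub_mul (z : ℂ) (hx : ContinuousOn x (Ioo (-a) a)) :
    ContinuousOn (fun t => (((t ^ 2 : ℝ) : ℂ) - z) * x t) (Ioo (-a) a) :=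
  (Continuous.continuousOn (by fun_prop)).mul hx

lemma hasDerivAt_primitive_of_continuousOn (hw : IntervalIntegrable w volume (-a) a)
    (hcont : ContinuousOn w (Ioo (-a) a)) (ht : t ∈ Ioo (-a) a) :
    HasDerivAt (primitive a w) (w t) t :=
  intervalIntegral.integral_hasDerivAt_right
    (intervalIntegrable_of_mem_Icc hw ⟨le_rfl, by linarith [ht.1, ht.2]⟩ (Ioo_subset_Icc_self ht))
    (hcont.stronglyMeasurableAtFilter isOpen_Ioo t ht) (hcont.continuousAt (isOpen_Ioo.mem_nhds ht))

lemma IsFluxSolution.hasDerivAt_flux (h : IsFluxSolution a w x)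
    (hcont : ContinuousOn w (Ioo (-a) a)) (ht : t ∈ Ioo (-a) a) :
    HasDerivAt (flux a x) (w t) t := by
  refine (hasDerivAt_primitive_of_continuousOn (h.intervalIntegrable (by linarith [ht.1, ht.2]))
    hcont ht).congr_of_eventuallyEq ?_
  filter_upwards [isOpen_Ioo.mem_nhds ht] with s hs using h.flux_eq hs

namespace IsFiniteSolution

lemma continuousOn (h : IsFiniteSolution a z x) : ContinuousOn x (Ioo (-a) a) := fun t ht =>
  (h.differentiableAt t ht).continuousAt.continuousWithinAt

lemma hasDerivAt_flux (h : IsFiniteSolution a z x) (ht : t ∈ Ioo (-a) a) :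
    HasDerivAt (flux a x) ((((t ^ 2 : ℝ) : ℂ) - z) * x t) t := by
  refine (differentiableAt_flux (h.differentiableAt_deriv t ht)).hasDerivAt.congr_deriv ?_
  have hequation := h.equation t ht
  rw [formalL] at hequation
  linear_combination -hequation

lemma mem_classA (h : IsFiniteSolution a z x) : x ∈ classA a := by
  have hflux : ContDiffOn ℝ 1 (flux a x) (Ioo (-a) a) := by
    refine (contDiffOn_succ_iff_deriv_of_isOpen (n := 0) isOpen_Ioo).2
      ⟨fun t ht => (h.hasDerivAt_flux ht).differentiableAt.differentiableWithinAt, by simp,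
        contDiffOn_zero.2 ?_⟩
    exact (continuousOn_sq_sub_mul z h.continuousOn).congr fun t ht => (h.hasDerivAt_flux ht).deriv
  have hderiv : ContDiffOn ℝ 1 (deriv x) (Ioo (-a) a) := by
    refine ((contDiff_weight a).contDiffOn.inv fun t ht => weight_ne_zero ht).mul hflux |>.congr
      fun t ht => ?_
    rw [deriv_eq_flux_div_weight x ht, div_eq_inv_mul, Pi.inv_apply]
  refine ⟨h.differentiableAt, fun α β hα hαβ hβ => ?_⟩
  refine (hderiv.mono ?_).absolutelyContinuousOnInterval
  rw [uIcc_of_le hαβ]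
  exact Icc_subset_Ioo hα hβ

lemma mem_domainI (ha : 0 < a) (h : IsFiniteSolution a z x) : x ∈ domainI a := by
  obtain ⟨ℓ, hleft⟩ := h.finite_left
  obtain ⟨ℓ', hright⟩ := h.finite_right
  have hx := memLp_of_tendsto h.continuousOn hleft hright
  refine mem_domainI_of_tendsto ha ⟨h.mem_classA, hx, ?_⟩ hleft hright
  refine (memLp_congr_ae ?_).1 (hx.const_smul z)
  filter_upwards [ae_restrict_mem measurableSet_Ioo] with t ht using (h.equation t ht).symm

end IsFiniteSolution

lemma isFiniteSolution_iff (ha : 0 < a) : IsFiniteSolution a z x ↔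
    IsFluxSolution a (fun t => (((t ^ 2 : ℝ) : ℂ) - z) * x t) x := by
  constructor
  · intro h
    refine (isFluxSolution_of_mem_domainI ha (h.mem_domainI ha)).congr_ae ha ?_
    filter_upwards [ae_restrict_mem measurableSet_Ioo] with t ht using (h.hasDerivAt_flux ht).deriv
  · intro h
    have hflux {t : ℝ} (ht : t ∈ Ioo (-a) a) := h.hasDerivAt_flux (continuousOn_sq_sub_mul z
      fun s hs => (h.hasDerivAt s hs).continuousAt.continuousWithinAt) ht
    have hcont := h.continuousOn_add_solve ha
    refine ⟨fun t ht => (h.hasDerivAt t ht).differentiableAt, fun t ht => ?_, fun t ht => ?_,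
      ⟨_, (tendsto_left_of_continuousOn ha hcont).congr' ?_⟩,
      ⟨_, (tendsto_right_of_continuousOn ha hcont).congr' ?_⟩⟩
    · refine ((hflux ht).differentiableAt.div ((contDiff_weight a).differentiable one_ne_zero t)
        (weight_ne_zero ht)).congr_of_eventuallyEq ?_
      filter_upwards [isOpen_Ioo.mem_nhds ht] with s hs using deriv_eq_flux_div_weight x hs
    · rw [formalL, (hflux ht).deriv]
      ring
    · filter_upwards [Ioo_mem_nhdsGT (by linarith : -a < a)] with t ht
      exact (h.eq_add_solve ht).symm
    · filter_upwards [Ioo_mem_nhdsLT (by linarith : -a < a)] with t ht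
      exact (h.eq_add_solve ht).symm

lemma mem_eigenspace_iff_mem_graph {E : Type*} [NormedAddCommGroup E] [NormedSpace ℂ E]
    {A : E →ₗ.[ℂ] E} {f : E} : f ∈ eigenspace A z ↔ (f, z • f) ∈ A.graph := by
  rw [LinearPMap.mem_graph_iff]
  constructor
  · rintro ⟨hf, hAf⟩
    exact ⟨⟨f, hf⟩, rfl, hAf⟩
  · rintro ⟨⟨g, hg⟩, rfl, hAg⟩
    exact ⟨hg, hAg⟩

lemma mem_eigenspace_operatorI_iff (ha : 0 < a) {f : HilbertL2 a} :
    f ∈ eigenspace (operatorI a ha) z ↔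
      ∃ e, IsFiniteSolution a z e ∧ f =ᵐ[intervalMeasure a] e := by
  rw [mem_eigenspace_iff_mem_graph, mem_graph_operatorI_iff]
  constructor
  · rintro ⟨w, x, h, hf, hg⟩
    refine ⟨x, (isFiniteSolution_iff ha).2 (h.congr_ae ha ?_), hf⟩
    filter_upwards [hf, hg, Lp.coeFn_smul z f] with t hft hgt hsmul
    rw [hsmul, Pi.smul_apply, smul_eq_mul, hft] at hgt
    linear_combination hgt
  · rintro ⟨e, he, hf⟩
    refine ⟨_, e, (isFiniteSolution_iff ha).1 he, hf, ?_⟩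
    filter_upwards [hf, Lp.coeFn_smul z f] with t hft hsmul
    rw [hsmul, Pi.smul_apply, smul_eq_mul, hft]
    ring

lemma IsFiniteSolution.exists_mem_eigenspace (ha : 0 < a) (h : IsFiniteSolution a z x) :
    ∃ f ∈ eigenspace (operatorI a ha) z, f =ᵐ[intervalMeasure a] x := by
  have hx := (h.mem_domainI ha).1.2.1
  exact ⟨hx.toLp x, (mem_eigenspace_operatorI_iff ha).2 ⟨x, h, hx.coeFn_toLp⟩, hx.coeFn_toLp⟩

lemma ne_zero_iff_exists_ne_zero {f : HilbertL2 a} (hx : ContinuousOn x (Ioo (-a) a))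
    (hf : f =ᵐ[intervalMeasure a] x) : f ≠ 0 ↔ ∃ t ∈ Ioo (-a) a, x t ≠ 0 := by
  refine not_iff_comm.1 ?_
  push Not
  constructor
  · intro hzero
    refine Lp.ext (hf.trans (.trans ?_ (Lp.coeFn_zero ℂ 2 (intervalMeasure a)).symm))
    filter_upwards [ae_restrict_mem measurableSet_Ioo] with t ht using hzero t ht
  · rintro rfl
    exact Measure.eqOn_open_of_ae_eq (hf.symm.trans (Lp.coeFn_zero _ _ _)) isOpen_Ioo hx
      continuousOn_const

lemma hasEigenvalue_operatorI_iff (ha : 0 < a) : HasEigenvalue (operatorI a ha) z ↔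
    ∃ e, IsFiniteSolution a z e ∧ ∃ t ∈ Ioo (-a) a, e t ≠ 0 := by
  constructor
  · rintro ⟨f, hf, hne⟩
    obtain ⟨e, he, hfe⟩ := (mem_eigenspace_operatorI_iff ha).1 hf
    exact ⟨e, he, (ne_zero_iff_exists_ne_zero he.continuousOn hfe).1 hne⟩
  · rintro ⟨e, he, hne⟩
    obtain ⟨f, hf, hfe⟩ := he.exists_mem_eigenspace ha
    exact ⟨f, hf, (ne_zero_iff_exists_ne_zero he.continuousOn hfe).2 hne⟩

end Eigenfunction

section LinearODE

variable {𝕜 E : Type*} [NontriviallyNormedField 𝕜] [NormedAddCommGroup E] [NormedSpace ℝ E]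
  [NormedSpace 𝕜 E]

lemma eqOn_Ioo_of_hasDerivAt_clm_apply {A : ℝ → E →L[𝕜] E} {u v : ℝ → E} {α β t₀ : ℝ}
    (hA : ContinuousOn A (Ioo α β)) (ht₀ : t₀ ∈ Ioo α β)
    (hu : ∀ t ∈ Ioo α β, HasDerivAt u (A t (u t)) t)
    (hv : ∀ t ∈ Ioo α β, HasDerivAt v (A t (v t)) t) (heq : u t₀ = v t₀) :
    EqOn u v (Ioo α β) := by
  intro t ht
  obtain ⟨α', hα, hα'⟩ := exists_between (lt_min ht.1 ht₀.1)
  obtain ⟨β', hβ', hβ⟩ := exists_between (max_lt ht.2 ht₀.2)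
  rw [lt_min_iff] at hα'
  rw [max_lt_iff] at hβ'
  have hsub : Icc α' β' ⊆ Ioo α β := Icc_subset_Ioo hα hβ
  obtain ⟨K, hK⟩ := isCompact_Icc.exists_bound_of_continuousOn (hA.mono hsub)
  have hLipschitz : ∀ s ∈ Ioo α' β', LipschitzOnWith K.toNNReal (A s) univ := fun s hs =>
    ((A s).lipschitz.weaken (NNReal.coe_le_coe.1
      ((hK s (Ioo_subset_Icc_self hs)).trans K.le_coe_toNNReal))).lipschitzOnWith
  exact ODE_solution_unique_of_mem_Ioo hLipschitz ⟨hα'.2, hβ'.2⟩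
    (fun s hs => ⟨hu s (hsub (Ioo_subset_Icc_self hs)), mem_univ _⟩)
    (fun s hs => ⟨hv s (hsub (Ioo_subset_Icc_self hs)), mem_univ _⟩) heq ⟨hα'.1, hβ'.1⟩

end LinearODE

section Multiplicity

variable {a : ℝ} {z : ℂ} {x y : ℝ → ℂ} {t : ℝ}

/-- The coefficient of the first-order system `(x, u)' = (u / p, (t² - z) x)` that the equation
`L x = z x` becomes for the pair of `x` and its flux `u = p x'`. -/
noncomputable def systemMatrix (a : ℝ) (z : ℂ) (t : ℝ) : ℂ × ℂ →L[ℂ] ℂ × ℂ :=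
  (weight a t : ℂ)⁻¹ • (ContinuousLinearMap.inl ℂ ℂ ℂ).comp (ContinuousLinearMap.snd ℂ ℂ ℂ) +
    (((t ^ 2 : ℝ) : ℂ) - z) •
      (ContinuousLinearMap.inr ℂ ℂ ℂ).comp (ContinuousLinearMap.fst ℂ ℂ ℂ)

lemma systemMatrix_apply (a : ℝ) (z : ℂ) (t : ℝ) (q : ℂ × ℂ) :
    systemMatrix a z t q = (q.2 / weight a t, (((t ^ 2 : ℝ) : ℂ) - z) * q.1) := by
  simp [systemMatrix, div_eq_inv_mul]

lemma continuousOn_systemMatrix (a : ℝ) (z : ℂ) :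
    ContinuousOn (systemMatrix a z) (Ioo (-a) a) :=
  (((contDiff_weight a).continuous.continuousOn.inv₀ fun _ => weight_ne_zero).smul
    continuousOn_const).add (Continuous.continuousOn (by fun_prop))

lemma exists_eq_smul_of_mul_eq_mul {K : Type*} [Field K] {p q : K × K} (hp : p ≠ 0)
    (hpq : p.1 * q.2 = p.2 * q.1) : ∃ c : K, q = c • p := by
  by_cases h1 : p.1 = 0
  · have h2 : p.2 ≠ 0 := fun h2 => hp (Prod.ext h1 h2)
    refine ⟨q.2 / p.2, Prod.ext ?_ (div_mul_cancel₀ _ h2).symm⟩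
    simpa [h1, h2] using hpq
  · refine ⟨q.1 / p.1, Prod.ext (div_mul_cancel₀ _ h1).symm ?_⟩
    simp only [Prod.smul_snd, smul_eq_mul]
    field_simp
    linear_combination hpq

namespace IsFiniteSolution

lemma hasDerivAt_system (h : IsFiniteSolution a z x) (ht : t ∈ Ioo (-a) a) :
    HasDerivAt (fun s => (x s, flux a x s)) (systemMatrix a z t (x t, flux a x t)) t := by
  rw [systemMatrix_apply, ← deriv_eq_flux_div_weight x ht]
  exact (h.differentiableAt t ht).hasDerivAt.prodMk (h.hasDerivAt_flux ht)

lemma tendsto_flux_left (ha : 0 < a) (h : IsFiniteSolution a z x) :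
    Tendsto (flux a x) (𝓝[>] (-a)) (𝓝 0) :=
  (tendsto_flux_left_zero_iff ha).2 (h.mem_domainI ha).2.1

lemma wronskian_eq_zero (hx : IsFiniteSolution a z x) (hy : IsFiniteSolution a z y)
    (ht : t ∈ Ioo (-a) a) : x t * flux a y t - flux a x t * y t = 0 := by
  have ha : 0 < a := by linarith [ht.1, ht.2]
  have hderiv : ∀ s ∈ Ioo (-a) a,
      HasDerivAt (fun s => x s * flux a y s - flux a x s * y s) 0 s := fun s hs => by
    refine (((hx.differentiableAt s hs).hasDerivAt.mul (hy.hasDerivAt_flux hs)).sub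
      ((hx.hasDerivAt_flux hs).mul (hy.differentiableAt s hs).hasDerivAt)).congr_deriv ?_
    rw [flux, flux]
    ring
  have hconst : ∀ s ∈ Ioo (-a) a,
      x s * flux a y s - flux a x s * y s = x t * flux a y t - flux a x t * y t := fun s hs =>
    isOpen_Ioo.is_const_of_deriv_eq_zero isPreconnected_Ioo
      (fun r hr => (hderiv r hr).differentiableAt.differentiableWithinAt)
      (fun r hr => (hderiv r hr).deriv) hs ht
  obtain ⟨ℓ, hℓ⟩ := hx.finite_left
  obtain ⟨ℓ', hℓ'⟩ := hy.finite_left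
  have hlim := (hℓ.mul (hy.tendsto_flux_left ha)).sub ((hx.tendsto_flux_left ha).mul hℓ')
  rw [mul_zero, zero_mul, sub_zero] at hlim
  refine tendsto_nhds_unique_of_eventuallyEq tendsto_const_nhds hlim ?_
  filter_upwards [Ioo_mem_nhdsGT (by linarith : -a < a)] with s hs using (hconst s hs).symm

lemma exists_eqOn_smul (hx : IsFiniteSolution a z x) (hy : IsFiniteSolution a z y)
    (hne : ∃ t ∈ Ioo (-a) a, x t ≠ 0) : ∃ c : ℂ, EqOn y (c • x) (Ioo (-a) a) := by
  obtain ⟨t₀, ht₀, hne⟩ := hne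
  obtain ⟨c, hc⟩ := exists_eq_smul_of_mul_eq_mul (p := (x t₀, flux a x t₀))
    (q := (y t₀, flux a y t₀)) (fun h => hne (congrArg Prod.fst h))
    (sub_eq_zero.1 (hx.wronskian_eq_zero hy ht₀))
  have hunique := eqOn_Ioo_of_hasDerivAt_clm_apply (continuousOn_systemMatrix a z) ht₀
    (fun s hs => hy.hasDerivAt_system hs)
    (v := fun s => c • (x s, flux a x s)) (fun s hs => by
      rw [map_smul]
      exact (hx.hasDerivAt_system hs).const_smul c) hc
  exact ⟨c, fun s hs => congrArg Prod.fst (hunique hs)⟩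

end IsFiniteSolution

lemma finrank_eigenspace_operatorI (ha : 0 < a) (hz : HasEigenvalue (operatorI a ha) z) :
    Module.finrank ℂ (eigenspace (operatorI a ha) z) = 1 := by
  obtain ⟨f, hf, hne⟩ := hz
  obtain ⟨x, hx, hfx⟩ := (mem_eigenspace_operatorI_iff ha).1 hf
  refine finrank_eq_one (⟨f, hf⟩ : eigenspace (operatorI a ha) z)
    (fun h => hne (congrArg Subtype.val h)) fun ⟨g, hg⟩ => ?_
  obtain ⟨y, hy, hgy⟩ := (mem_eigenspace_operatorI_iff ha).1 hg
  obtain ⟨c, hc⟩ :=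
    hx.exists_eqOn_smul hy ((ne_zero_iff_exists_ne_zero hx.continuousOn hfx).1 hne)
  refine ⟨c, Subtype.ext (Lp.ext ((Lp.coeFn_smul c f).trans ?_))⟩
  filter_upwards [hfx, hgy, ae_restrict_mem measurableSet_Ioo] with t hft hgt ht
  rw [Pi.smul_apply, hft, hgt, hc ht, Pi.smul_apply]

end Multiplicity

section InfiniteDimension

variable {a : ℝ}

lemma memLp_polynomial (a : ℝ) (q : Polynomial ℂ) :
    MemLp (fun t : ℝ => q.eval (t : ℂ)) 2 (intervalMeasure a) :=
  memLp_of_continuousOn (Continuous.continuousOn (by fun_prop))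

/-- The class in `L²((-a, a))` of a polynomial function. -/
noncomputable def polynomialToL2 (a : ℝ) : Polynomial ℂ →ₗ[ℂ] HilbertL2 a where
  toFun q := (memLp_polynomial a q).toLp _
  map_add' p q := by
    rw [← MemLp.toLp_add]
    exact MemLp.toLp_congr _ _ (ae_of_all _ fun t => by simp)
  map_smul' c q := by
    rw [RingHom.id_apply, ← MemLp.toLp_const_smul]
    exact MemLp.toLp_congr _ _ (ae_of_all _ fun t => by simp)

lemma polynomialToL2_injective (ha : 0 < a) : Function.Injective (polynomialToL2 a) := by
  refine (injective_iff_map_eq_zero _).2 fun q hq => ?_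
  have hzero : EqOn (fun t : ℝ => q.eval (t : ℂ)) 0 (Ioo (-a) a) :=
    Measure.eqOn_open_of_ae_eq ((Lp.coeFn_zero ℂ 2 (intervalMeasure a)).symm.trans
      (hq ▸ (memLp_polynomial a q).coeFn_toLp)).symm isOpen_Ioo
      (Continuous.continuousOn (by fun_prop)) continuousOn_const
  refine Polynomial.eq_zero_of_infinite_isRoot q
    (((Ioo_infinite (by linarith : -a < a)).image Complex.ofReal_injective.injOn).mono ?_)
  rintro _ ⟨t, ht, rfl⟩
  exact hzero ht

lemma not_finiteDimensional_hilbertL2 (ha : 0 < a) : ¬ FiniteDimensional ℂ (HilbertL2 a) :=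
  fun _ => Polynomial.not_finite (R := ℂ)
    (Module.Finite.of_injective _ (polynomialToL2_injective ha))

end InfiniteDimension

end Prolate

theorem theorem4p3 (a : ℝ) (ha : 0 < a) :
    IsSelfAdjoint (Prolate.operatorI a ha) ∧
    Prolate.HasDiscreteSpectrum (Prolate.operatorI a ha) ∧
    (∃ μ : ℕ → ℝ, StrictMono μ ∧ (∀ n, 0 < μ n) ∧ Tendsto μ atTop atTop ∧
      Prolate.spectrum (Prolate.operatorI a ha) = Set.range (fun n => (μ n : ℂ)) ∧
      ∀ n, Module.finrank ℂ (Prolate.eigenspace (Prolate.operatorI a ha) (μ n : ℂ)) = 1) ∧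
    (∀ z : ℂ, Prolate.HasEigenvalue (Prolate.operatorI a ha) z ↔
      ∃ e : ℝ → ℂ, Prolate.IsFiniteSolution a z e ∧ ∃ t ∈ Set.Ioo (-a) a, e t ≠ 0) ∧
    (∀ (z : ℂ) (e : ℝ → ℂ), Prolate.IsFiniteSolution a z e →
      (∃ t ∈ Set.Ioo (-a) a, e t ≠ 0) →
      ∃ f ∈ Prolate.eigenspace (Prolate.operatorI a ha) z, f ≠ 0 ∧
        (f : ℝ → ℂ) =ᵐ[Prolate.intervalMeasure a] e) := by
  have hA := Prolate.hasPositiveForm_operatorI ha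
  obtain ⟨R, hR, hinv⟩ := Prolate.exists_compact_isInverse_operatorI ha
  refine ⟨hinv.isSelfAdjoint (hinv.isSymmetric hA), hinv.hasDiscreteSpectrum hR hA, ?_,
    fun _ => Prolate.hasEigenvalue_operatorI_iff ha, fun z e he hne => ?_⟩
  · obtain ⟨μ, hmono, hpos, htop, hspectrum⟩ :=
      hinv.exists_spectrum_eq_range hR hA (Prolate.not_finiteDimensional_hilbertL2 ha)
    refine ⟨μ, hmono, hpos, htop, hspectrum, fun n => ?_⟩
    exact Prolate.finrank_eigenspace_operatorI ha
      ((hinv.mem_spectrum_iff hR).1 (hspectrum ▸ mem_range_self n))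
  · obtain ⟨f, hf, hfe⟩ := he.exists_mem_eigenspace ha
    exact ⟨f, hf, (Prolate.ne_zero_iff_exists_ne_zero he.continuousOn hfe).2 hne, hfe⟩
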